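/- Let $\rho\ge 0$ and $\bar\alpha,\bar\beta\in\mathbb R$. Let $\mathcal H_\rho$ be the Hilbert space of all $v:\mathbb Z\to\mathbb C$ with $\|v\|_\rho^2=\sum_{j\in\mathbb Z}\cosh(2j\rho)|v_j|^2<\infty$, and let $\mathcal H_\rho^2$ be the Hilbert space of pairs $(v,\nu)$ with $v,\nu\in\mathcal H_\rho$. Write $(\nabla_0 v)_j=v_j-v_{j-1}$ and $(\nabla_0^*v)_j=-(v_{j+1}-v_j)$. Let $\tilde\alpha_j,\tilde\beta_j:\mathbb R\to\mathbb R$ $(j\in\mathbb Z)$ be continuous and $2\pi$-periodic functions such that, for some $\rho_0>0$, the quantities $\cosh(2\rho_0 j)^{1/2}|\tilde\alpha_j(t)|$ and $\cosh(2\rho_0 j)^{1/2}|\tilde\beta_j(t)|$ are bounded uniformly in $j\in\mathbb Z$ and $t\in\mathbb R$. Put $$H_0=\bar\alpha\nabla_0^*\nabla_0+\bar\beta,\qquad H_1(t)v=\nabla_0^*\tilde\alpha(t)\nabla_0v+\tilde\beta(t)v,\qquad H(t)=H_0+H_1(t),$$ where $\tilde\alpha(t)$ and $\tilde\beta(t)$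 act by pointwise multiplication. Consider on $\mathcal H_\rho^2$ the linear equation $$\frac{d}{dt}\begin{bmatrix}v\\ \nu\end{bmatrix}=\begin{bmatrix}0&I\\-H(t)&0\end{bmatrix}\begin{bmatrix}v\\ \nu\end{bmatrix},\qquad t\in\mathbb R .$$ Let $h_0(\varphi)=2\bar\alpha(1-\cos\varphi)+\bar\beta$, let $R_\rho=\{h_0(\varphi):\varphi\in\mathbb C,\ |\operatorname{Im}\varphi|\le\rho\}$, let $iR_\rho^{1/2}=\{z\in\mathbb C:-z^2\in R_\rho\}$, and let $$\Sigma_\rho^e=\exp\bigl(2\pi iR_\rho^{1/2}\bigr)=\{e^{2\pi z}:-z^2\in R_\rho\}.$$ **Theorem 2.4.** The equation has a unique family $\Phi(t)$, $t\in\mathbb R$, of time-$t$ maps $(v(0),\nu(0))\mapsto(v(t),\nu(t))$, and these are bounded linear operators on $\mathcal H_\rho^2$. Assume that $\mathbb C\setminus\Sigma_\rho^e$ is connected. Then every point of the spectrum of $\Phi(2\pi):\mathcal H_\rho^2\to\mathcal H_\rho^2$ that lies outside $\Sigma_\rho^e$ is an eigenvalue of $\Phi(2\pi)$ of finite algebraic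 multiplicity (that is, it is an isolated point of the spectrum, and its Riesz projection $\frac1{2\pi i}\oint(z-\Phi(2\pi))^{-1}dz$ over a small circle around it has finite rank). These eigenvalues can accumulate only at $\Sigma_\rho^e$: every accumulation point in $\mathbb C$ of the set of these eigenvalues belongs to $\Sigma_\rho^e$. -/

import Mathlib

noncomputable section

namespace Breather

/-! ### Weighted sequence spaces -/

/-- The weight `cosh (2 j ρ)`. -/
def weight (ρ : ℝ) (j : ℤ) : ℝ := Real.cosh (2 * (j : ℝ) * ρ)

lemma weight_pos (ρ : ℝ) (j : ℤ) : 0 < weight ρ j := Real.cosh_pos _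

/-- The multiplication operator `U(ρ)`: `(U(ρ) v)_j = cosh (2 ρ j)^(1/2) v_j`. -/
def mulU (ρ : ℝ) : (ℤ → ℂ) →ₗ[ℂ] (ℤ → ℂ) where
  toFun v j := ((Real.sqrt (weight ρ j) : ℝ) : ℂ) * v j
  map_add' u v := by ext j; simp [mul_add]
  map_smul' c v := by ext j; simp [mul_left_comm]

lemma norm_mulU_sq (ρ : ℝ) (v : ℤ → ℂ) (j : ℤ) :
    ‖mulU ρ v j‖ ^ 2 = weight ρ j * ‖v j‖ ^ 2 := by
  simp [mulU, mul_pow, Real.sq_sqrt (weight_pos ρ j).le]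

lemma memℓp_mulU_iff (ρ : ℝ) (v : ℤ → ℂ) :
    Memℓp (mulU ρ v) 2 ↔ Summable fun j => weight ρ j * ‖v j‖ ^ 2 := by
  rw [memℓp_gen_iff (by simp)]
  simp [← norm_mulU_sq]

/-- The sequences `v : ℤ → ℂ` with `∑ j, cosh (2 j ρ) |v_j|² < ∞`. -/
def weightedL2 (ρ : ℝ) : Submodule ℂ (ℤ → ℂ) where
  carrier := {v | Summable fun j => weight ρ j * ‖v j‖ ^ 2}
  zero_mem' := by simp [summable_zero]
  add_mem' {u v} hu hv := by
    simp only [Set.mem_ofPred_eq, ← memℓp_mulU_iff, map_add] at *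
    exact hu.add hv
  smul_mem' c v hv := by
    simp only [Set.mem_ofPred_eq, ← memℓp_mulU_iff, map_smul] at *
    exact hv.const_smul c

/-- The space `H_ρ`, as a type of its own, so that it does not carry the topology of pointwise
convergence. -/
def Hsp (ρ : ℝ) : Type := weightedL2 ρ

instance (ρ : ℝ) : AddCommGroup (Hsp ρ) := inferInstanceAs (AddCommGroup (weightedL2 ρ))

instance (ρ : ℝ) : Module ℂ (Hsp ρ) := inferInstanceAs (Module ℂ (weightedL2 ρ))

instance (ρ : ℝ) : CoeFun (Hsp ρ) (fun _ => ℤ → ℂ) := ⟨fun v => v.1⟩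

/-- `U(ρ)` as a bijection from `H_ρ` to `ℓ²(ℤ)`. The Hilbert space structure of `H_ρ` is the one
that makes `U(ρ)` unitary; see `inner_eq` and `norm_sq_eq` for the explicit formulas. -/
def toL2 (ρ : ℝ) : Hsp ρ ≃ₗ[ℂ] lp (fun _ : ℤ => ℂ) 2 where
  toFun v := ⟨mulU ρ v, (memℓp_mulU_iff ρ v.1).2 v.2⟩
  invFun w := ⟨fun j => ((Real.sqrt (weight ρ j) : ℝ) : ℂ)⁻¹ * w j, by
    change Summable _
    rw [← memℓp_mulU_iff]
    convert lp.memℓp w using 1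
    ext j
    have : ((Real.sqrt (weight ρ j) : ℝ) : ℂ) ≠ 0 := by
      exact_mod_cast (Real.sqrt_pos.2 (weight_pos ρ j)).ne'
    simp [mulU, mul_inv_cancel_left₀ this]⟩
  left_inv v := by
    apply Subtype.ext
    ext j
    have : ((Real.sqrt (weight ρ j) : ℝ) : ℂ) ≠ 0 := by
      exact_mod_cast (Real.sqrt_pos.2 (weight_pos ρ j)).ne'
    simp [mulU, inv_mul_cancel_left₀ this]
  right_inv w := by
    apply Subtype.ext
    funext j
    have : ((Real.sqrt (weight ρ j) : ℝ) : ℂ) ≠ 0 := by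
      exact_mod_cast (Real.sqrt_pos.2 (weight_pos ρ j)).ne'
    simp [mulU, mul_inv_cancel_left₀ this]
  map_add' u v := Subtype.ext ((mulU ρ).map_add u.1 v.1)
  map_smul' c v := Subtype.ext ((mulU ρ).map_smul c v.1)

lemma toL2_apply (ρ : ℝ) (v : Hsp ρ) (j : ℤ) :
    toL2 ρ v j = ((Real.sqrt (weight ρ j) : ℝ) : ℂ) * v j := rfl

instance (ρ : ℝ) : NormedAddCommGroup (Hsp ρ) :=
  NormedAddCommGroup.induced (Hsp ρ) (lp (fun _ : ℤ => ℂ) 2) (toL2 ρ) (toL2 ρ).injective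

instance (ρ : ℝ) : InnerProductSpace ℂ (Hsp ρ) := InnerProductSpace.induced (toL2 ρ)

/-- `⟨u, v⟩_ρ = ∑ j, cosh (2 j ρ) conj(u_j) v_j`. -/
lemma inner_eq (ρ : ℝ) (u v : Hsp ρ) :
    inner ℂ u v = ∑' j : ℤ, (weight ρ j : ℂ) * (starRingEnd ℂ (u j) * v j) := by
  change inner ℂ (toL2 ρ u) (toL2 ρ v) = _
  rw [lp.inner_eq_tsum]
  refine tsum_congr fun j => ?_
  have h : ((Real.sqrt (weight ρ j) : ℝ) : ℂ) * ((Real.sqrt (weight ρ j) : ℝ) : ℂ)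
      = (weight ρ j : ℂ) := by
    rw [← Complex.ofReal_mul, Real.mul_self_sqrt (weight_pos ρ j).le]
  rw [toL2_apply, toL2_apply, RCLike.inner_apply, map_mul, Complex.conj_ofReal]
  rw [← h]
  ring

/-- `‖v‖_ρ² = ∑ j, cosh (2 j ρ) |v_j|²`. -/
lemma norm_sq_eq (ρ : ℝ) (v : Hsp ρ) : ‖v‖ ^ 2 = ∑' j : ℤ, weight ρ j * ‖v j‖ ^ 2 := by
  change ‖toL2 ρ v‖ ^ 2 = _
  have h := lp.norm_rpow_eq_tsum (p := 2) (by simp) (toL2 ρ v)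
  simp only [ENNReal.toReal_ofNat, Real.rpow_ofNat] at h
  rw [h]
  exact tsum_congr fun j => norm_mulU_sq ρ v j

instance (ρ : ℝ) : CompleteSpace (Hsp ρ) :=
  (IsometryEquiv.mk (toL2 ρ).toEquiv (AddMonoidHomClass.isometry_of_norm (toL2 ρ)
    fun _ => rfl)).completeSpace

/-- The space `H_ρ²` of pairs `(v, ν)` in `H_ρ`, with the Hilbert sum norm. -/
abbrev Hsp2 (ρ : ℝ) : Type := WithLp 2 (Hsp ρ × Hsp ρ)

/-! ### The flow -/

/-- The lattice gradient `(∇₀ v)_j = v_j - v_{j-1}`. -/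
def grad (v : ℤ → ℂ) (j : ℤ) : ℂ := v j - v (j - 1)

/-- The adjoint lattice gradient `(∇₀* v)_j = -(v_{j+1} - v_j)`. -/
def gradAdj (v : ℤ → ℂ) (j : ℤ) : ℂ := -(v (j + 1) - v j)

/-- `H₀ v = ᾱ ∇₀* ∇₀ v + β̄ v`. -/
def opH0 (a b : ℝ) (v : ℤ → ℂ) (j : ℤ) : ℂ := a * gradAdj (grad v) j + b * v j

/-- `H₁(t) v = ∇₀* α̃(t) ∇₀ v + β̃(t) v`. -/
def opH1 (α β : ℤ → ℝ → ℝ) (t : ℝ) (v : ℤ → ℂ) (j : ℤ) : ℂ :=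
  gradAdj (fun i => α i t * grad v i) j + β j t * v j

/-- The condition on the pair of coefficients `(α̃, β̃)`: every `α̃_j` and `β̃_j` is continuous and
`2π`-periodic, and for some `ρ₀ > 0` the sequences `U(ρ₀) α̃(t)` and `U(ρ₀) β̃(t)` are bounded,
uniformly in `t`. -/
structure IsAdmissible (α β : ℤ → ℝ → ℝ) : Prop where
  continuous_left : ∀ j, Continuous (α j)
  continuous_right : ∀ j, Continuous (β j)
  periodic_left : ∀ j, Function.Periodic (α j) (2 * Real.pi)
  periodic_right : ∀ j, Function.Periodic (β j) (2 * Real.pi)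
  decay : ∃ ρ₀ > 0, ∃ C : ℝ, ∀ (t : ℝ) (j : ℤ),
    Real.sqrt (weight ρ₀ j) * |α j t| ≤ C ∧ Real.sqrt (weight ρ₀ j) * |β j t| ≤ C

/-- The curve `t ↦ (v(t), ν(t))` in `H_ρ²` is differentiable, for the norm of `H_ρ²`, and solves
`(v', ν') = X(t) (v, ν) = (ν, -(H₀ + H₁(t)) v)`. -/
def IsSolution (ρ a b : ℝ) (α β : ℤ → ℝ → ℝ) (u : ℝ → Hsp2 ρ) : Prop :=
  ∀ t : ℝ, ∃ w : Hsp2 ρ, HasDerivAt u w t ∧ w.fst = (u t).snd ∧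
    ∀ j : ℤ, w.snd j = -(opH0 a b (u t).fst j + opH1 α β t (u t).fst j)

/-- `Φ` is the family of time-`t` maps `u(0) ↦ u(t)` on `H_ρ²`, as bounded operators. -/
def IsFlow (ρ a b : ℝ) (α β : ℤ → ℝ → ℝ) (Φ : ℝ → Hsp2 ρ →L[ℂ] Hsp2 ρ) : Prop :=
  ∀ u₀ : Hsp2 ρ, Φ 0 u₀ = u₀ ∧ IsSolution ρ a b α β fun t => Φ t u₀

/-! ### The exceptional set -/

/-- The multiplier `h₀(φ) = 2 ᾱ (1 - cos φ) + β̄`. -/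
def h0 (a b : ℝ) (φ : ℂ) : ℂ := 2 * a * (1 - Complex.cos φ) + b

/-- The strip `S_ρ = {φ : |Im φ| ≤ ρ}`. -/
def strip (ρ : ℝ) : Set ℂ := {φ | |φ.im| ≤ ρ}

/-- The range `R_ρ` of `h₀` on the strip. -/
def rangeR (a b ρ : ℝ) : Set ℂ := h0 a b '' strip ρ

/-- The set `i R_ρ^{1/2} = {z : -z² ∈ R_ρ}`. -/
def iSqrtR (a b ρ : ℝ) : Set ℂ := {z | -z ^ 2 ∈ rangeR a b ρ}

/-- The set `Σ_ρ^e = exp (2π i R_ρ^{1/2})`. -/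
def SigmaE (a b ρ : ℝ) : Set ℂ := (fun z : ℂ => Complex.exp (2 * Real.pi * z)) '' iSqrtR a b ρ

/-! ### Algebraic multiplicity -/

/-- The Riesz projection `(2πi)⁻¹ ∮_{|z - c| = r} (z - A)⁻¹ dz`. -/
def rieszProj {E : Type*} [NormedAddCommGroup E] [NormedSpace ℂ E] (A : E →L[ℂ] E)
    (c : ℂ) (r : ℝ) : E →L[ℂ] E :=
  (2 * Real.pi * Complex.I)⁻¹ • circleIntegral (fun z => resolvent A z) c r

/-- The point `c` is isolated from the rest of the spectrum of `A`, and the associated Riesz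
projection has finite rank. That rank, which does not depend on the radius of the circle,
is the algebraic multiplicity of `c`. -/
def HasFiniteAlgMultiplicity {E : Type*} [NormedAddCommGroup E] [NormedSpace ℂ E]
    (A : E →L[ℂ] E) (c : ℂ) : Prop :=
  ∃ r > 0, Metric.closedBall c r ∩ spectrum ℂ A ⊆ {c} ∧
    FiniteDimensional ℂ (LinearMap.range (rieszProj A c r : E →ₗ[ℂ] E))

end Breather

end

/-! Let A₀ be the generator of the unperturbed equation (`freeGen`). The coefficients α̃_j(t),
β̃_j(t) tend to 0 as |j| → ∞, uniformly in t, so H₁(t) is a norm limit of finite-rank operators.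
Such limits form a closed two-sided ideal (`approxOps`), and variation of constants puts Φ(2π) -
exp(2πA₀) in it (`exists_flow`).

The spectrum of exp(2πA₀) lies in Σ (`spectrum_exp_freeGen_subset`). Each of its points is exp(2π
f(A₀)) for a character f of a commutative Banach algebra containing A₀ and the shifts S₁, S₋₁.
Writing f(S₁) = e^{iφ}, the bounds ‖S₁‖, ‖S₋₁‖ ≤ e^ρ give |Im φ| ≤ ρ, and A₀² = -H₀ gives -f(A₀)² =
h₀(φ).

Off Σ the analytic Fredholm theorem (`analytic_fredholm`) then applies. Near a given point, the
perturbation is reduced to one of finite rank XY of some M, and the spectrum becomes the zero set of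
the holomorphic function det(1 - Y(z - M)⁻¹X). A zero yields an eigenvector; a zero of finite order
yields a pole of the resolvent with finite-rank Riesz projection. Vanishing on an open set would
propagate over the connected complement of Σ, which is impossible because Σ and the spectrum are
bounded. -/

noncomputable section

namespace Breather

open Filter Topology

/-! ### Finite-rank operators and the closed ideal of their norm limits -/

section FiniteRank

variable {E F : Type*} [NormedAddCommGroup E] [NormedSpace ℂ E]
  [NormedAddCommGroup F] [NormedSpace ℂ F]

/-- The operators of finite rank. -/
def finiteRank (E F : Type*) [NormedAddCommGroup E] [NormedSpace ℂ E]
    [NormedAddCommGroup F] [NormedSpace ℂ F] : Submodule ℂ (E →L[ℂ] F) where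
  carrier := {T | FiniteDimensional ℂ (LinearMap.range (T : E →ₗ[ℂ] F))}
  zero_mem' := by
    have h : LinearMap.range ((0 : E →L[ℂ] F) : E →ₗ[ℂ] F) = ⊥ := by
      simp
    change FiniteDimensional ℂ (LinearMap.range ((0 : E →L[ℂ] F) : E →ₗ[ℂ] F))
    rw [h]
    infer_instance
  add_mem' {S T} hS hT := by
    simp only [Set.mem_ofPred_eq] at *
    refine Submodule.finiteDimensional_of_le (S₂ := LinearMap.range (S : E →ₗ[ℂ] F) ⊔
      LinearMap.range (T : E →ₗ[ℂ] F)) ?_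
    rintro _ ⟨x, rfl⟩
    exact Submodule.add_mem_sup ⟨x, rfl⟩ ⟨x, rfl⟩
  smul_mem' c T hT := by
    simp only [Set.mem_ofPred_eq] at *
    refine Submodule.finiteDimensional_of_le (S₂ := LinearMap.range (T : E →ₗ[ℂ] F)) ?_
    rintro _ ⟨x, rfl⟩
    exact ⟨c • x, by simp⟩

lemma mem_finiteRank {T : E →L[ℂ] F} :
    T ∈ finiteRank E F ↔ FiniteDimensional ℂ (LinearMap.range (T : E →ₗ[ℂ] F)) := Iff.rfl

lemma finiteRank_comp {G : Type*} [NormedAddCommGroup G] [NormedSpace ℂ G]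
    (A : F →L[ℂ] G) {T : E →L[ℂ] F} (hT : T ∈ finiteRank E F) : A ∘L T ∈ finiteRank E G := by
  rw [mem_finiteRank] at *
  have : LinearMap.range ((A ∘L T : E →L[ℂ] G) : E →ₗ[ℂ] G) =
      (LinearMap.range (T : E →ₗ[ℂ] F)).map (A : F →ₗ[ℂ] G) := by
    rw [← LinearMap.range_comp]; rfl
  rw [this]
  infer_instance

lemma comp_finiteRank {G : Type*} [NormedAddCommGroup G] [NormedSpace ℂ G]
    {T : F →L[ℂ] G} (hT : T ∈ finiteRank F G) (A : E →L[ℂ] F) : T ∘L A ∈ finiteRank E G := by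
  rw [mem_finiteRank] at *
  refine Submodule.finiteDimensional_of_le (S₂ := LinearMap.range (T : F →ₗ[ℂ] G)) ?_
  rintro _ ⟨x, rfl⟩
  exact ⟨A x, rfl⟩

lemma finiteRank_of_finiteDimensional [FiniteDimensional ℂ E] (T : E →L[ℂ] F) :
    T ∈ finiteRank E F := by
  rw [mem_finiteRank]; infer_instance

/-- An operator of finite rank factors through some `ℂⁿ`. -/
lemma exists_factor {T : E →L[ℂ] F} (hT : T ∈ finiteRank E F) :
    ∃ (n : ℕ) (X : (Fin n → ℂ) →L[ℂ] F) (Y : E →L[ℂ] (Fin n → ℂ)), T = X ∘L Y := by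
  rw [mem_finiteRank] at hT
  let e := (Module.finBasis ℂ (LinearMap.range (T : E →ₗ[ℂ] F))).equivFun.toContinuousLinearEquiv
  refine ⟨_, (LinearMap.range (T : E →ₗ[ℂ] F)).subtypeL ∘L
    e.symm.toContinuousLinearMap,
    e.toContinuousLinearMap ∘L T.codRestrict _
      (fun x => ⟨x, rfl⟩), ?_⟩
  ext x
  simp only [ContinuousLinearMap.comp_apply, ContinuousLinearEquiv.coe_coe,
    ContinuousLinearEquiv.symm_apply_apply, Submodule.subtypeL_apply]
  rfl

variable (E) in
/-- The norm limits of operators of finite rank. -/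
def approxOps : Submodule ℂ (E →L[ℂ] E) := (finiteRank E E).topologicalClosure

lemma isClosed_approxOps : IsClosed (approxOps E : Set (E →L[ℂ] E)) :=
  Submodule.isClosed_topologicalClosure _

lemma mul_mem_approxOps_left (A : E →L[ℂ] E) {T : E →L[ℂ] E} (hT : T ∈ approxOps E) :
    A * T ∈ approxOps E := by
  refine map_mem_closure (f := fun T => A * T) (by fun_prop) hT fun S hS => ?_
  exact finiteRank_comp A hS

lemma mul_mem_approxOps_right (A : E →L[ℂ] E) {T : E →L[ℂ] E} (hT : T ∈ approxOps E) :
    T * A ∈ approxOps E := by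
  refine map_mem_closure (f := fun T => T * A) (by fun_prop) hT fun S hS => ?_
  exact comp_finiteRank hS A

end FiniteRank

/-! ### Contour integrals around a pole -/

section Pole

variable {E F : Type*} [NormedAddCommGroup E] [NormedSpace ℂ E] [CompleteSpace E]
  [NormedAddCommGroup F] [NormedSpace ℂ F] [FiniteDimensional ℂ F]

/-- The circle integral of `(z - c)^(-m) X(z) Y(z)` has finite rank, when `X` and `Y` are
holomorphic and factor through a finite-dimensional space. -/
lemma circleIntegral_pole_mem_finiteRank {c : ℂ} {r : ℝ} (hr : 0 < r) {U : Set ℂ} (hU : IsOpen U)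
    (hrU : Metric.closedBall c r ⊆ U) {Y : ℂ → E →L[ℂ] F} (hY : DifferentiableOn ℂ Y U) (m : ℕ) :
    ∀ {X : ℂ → F →L[ℂ] E}, DifferentiableOn ℂ X U →
      circleIntegral (fun z => ((z - c) ^ m)⁻¹ • (X z ∘L Y z)) c r ∈ finiteRank E E := by
  have hcomp : ∀ {X : ℂ → F →L[ℂ] E}, DifferentiableOn ℂ X U →
      DifferentiableOn ℂ (fun z => X z ∘L Y z) U := fun hX => hX.clm_comp hY
  have hsph : Metric.sphere c r ⊆ U := Metric.sphere_subset_closedBall.trans hrU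
  have hne : ∀ z ∈ Metric.sphere c r, z - c ≠ 0 := fun z hz h => by
    rw [sub_eq_zero.1 h] at hz; simp at hz; exact hr.ne hz
  have hpow : ∀ k : ℕ, ContinuousOn (fun z : ℂ => ((z - c) ^ k)⁻¹) (Metric.sphere c r) := fun k =>
    ContinuousOn.inv₀ (by fun_prop) fun z hz => pow_ne_zero _ (hne z hz)
  induction m with
  | zero =>
    intro X hX
    have : circleIntegral (fun z => ((z - c) ^ 0)⁻¹ • (X z ∘L Y z)) c r = 0 := by
      simp only [pow_zero, inv_one, one_smul]
      refine Complex.circleIntegral_eq_zero_of_differentiable_on_off_countable hr.le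
        Set.countable_empty ((hcomp hX).continuousOn.mono hrU) fun z hz => ?_
      exact (hcomp hX).differentiableAt (hU.mem_nhds (hrU (Metric.ball_subset_closedBall hz.1)))
    rw [this]
    exact zero_mem _
  | succ m ih =>
    intro X hX
    have hcU : U ∈ 𝓝 c := hU.mem_nhds (hrU (Metric.mem_closedBall_self hr.le))
    have hD : DifferentiableOn ℂ (dslope X c) U := (Complex.differentiableOn_dslope hcU).2 hX
    have hYs : ContinuousOn Y (Metric.sphere c r) := hY.continuousOn.mono hsph
    have hI1 : CircleIntegrable (fun z => ((z - c) ^ (m + 1))⁻¹ • Y z) c r :=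
      ((hpow _).smul hYs).circleIntegrable hr.le
    have hI2 : CircleIntegrable (fun z => ((z - c) ^ m)⁻¹ • (dslope X c z ∘L Y z)) c r :=
      ((hpow _).smul ((hcomp hD).continuousOn.mono hsph)).circleIntegrable hr.le
    -- Expand X(z) = X(c) + (z - c) `dslope X c z`. The constant X(c) comes out of the integral, and
    -- that term factors through `F`; the remaining term has pole order one less.
    let L : (E →L[ℂ] F) →L[ℂ] (E →L[ℂ] E) := ContinuousLinearMap.compL ℂ E F E (X c)
    have hLI : circleIntegral (fun z => L (((z - c) ^ (m + 1))⁻¹ • Y z)) c r =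
        L (circleIntegral (fun z => ((z - c) ^ (m + 1))⁻¹ • Y z) c r) := by
      have := FiniteDimensional.complete ℂ F
      simp only [circleIntegral]
      rw [← ContinuousLinearMap.intervalIntegral_comp_comm _ hI1.out]
      simp only [map_smul]
    have hI1' : CircleIntegrable (fun z => L (((z - c) ^ (m + 1))⁻¹ • Y z)) c r :=
      (L.continuous.comp_continuousOn ((hpow _).smul hYs)).circleIntegrable hr.le
    have hsplit : circleIntegral (fun z => ((z - c) ^ (m + 1))⁻¹ • (X z ∘L Y z)) c r =
        circleIntegral (fun z => L (((z - c) ^ (m + 1))⁻¹ • Y z) +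
          ((z - c) ^ m)⁻¹ • (dslope X c z ∘L Y z)) c r := by
      refine circleIntegral.integral_congr hr.le fun z hz => ?_
      have hX' : X z = X c + (z - c) • dslope X c z := by
        rw [sub_smul_dslope]; abel
      have h0 := hne z hz
      have hp : ((z - c) ^ m)⁻¹ = ((z - c) ^ (m + 1))⁻¹ * (z - c) := by
        field_simp
        ring
      simp only [L, ContinuousLinearMap.compL_apply, ContinuousLinearMap.comp_smul]
      rw [hp, mul_smul, ← smul_add]
      congr 1
      conv_lhs => rw [hX']
      rw [ContinuousLinearMap.add_comp, ContinuousLinearMap.smul_comp]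
    rw [hsplit, circleIntegral.integral_add hI1' hI2, hLI]
    refine add_mem ?_ (ih hD)
    exact comp_finiteRank (finiteRank_of_finiteDimensional (X c)) _

end Pole

/-! ### Perturbation of the spectrum and the analytic Fredholm theorem -/

section Local

variable {E F : Type*} [NormedAddCommGroup E] [NormedSpace ℂ E]

/-- The resolvent of a perturbation `M + X Y` expressed through the inverse `G` of
`1 - Y (z - M)⁻¹ X`. -/
lemma resolvent_add_comp [NormedAddCommGroup F] [NormedSpace ℂ F]
    (M : E →L[ℂ] E) (X : F →L[ℂ] E) (Y : E →L[ℂ] F) {z : ℂ} (hz : z ∈ resolventSet ℂ M)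
    (G : F →L[ℂ] F) (hG : ∀ v, G v - Y (resolvent M z (X (G v))) = v)
    (hG' : ∀ v, G (v - Y (resolvent M z (X v))) = v) :
    z ∈ resolventSet ℂ (M + X ∘L Y) ∧ resolvent (M + X ∘L Y) z =
      resolvent M z + (resolvent M z ∘L X) ∘L (G ∘L (Y ∘L resolvent M z)) := by
  set W : E →L[ℂ] E := algebraMap ℂ (E →L[ℂ] E) z - M with hW
  have hWu : IsUnit W := hz
  have h1 : ∀ x, W (resolvent M z x) = x := fun x =>
    congrArg (fun T : E →L[ℂ] E => T x) (Ring.mul_inverse_cancel W hWu)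
  have h2 : ∀ x, resolvent M z (W x) = x := fun x =>
    congrArg (fun T : E →L[ℂ] E => T x) (Ring.inverse_mul_cancel W hWu)
  set R := resolvent M z with hR
  let u : (E →L[ℂ] E)ˣ :=
    { val := algebraMap ℂ (E →L[ℂ] E) z - (M + X ∘L Y)
      inv := R + (R ∘L X) ∘L (G ∘L (Y ∘L R))
      val_inv := by
        rw [← sub_sub, ← hW]
        ext x
        have h3 := congrArg X (hG (Y (R x)))
        rw [map_sub] at h3
        simp only [mul_apply_eq_comp, add_apply,
          sub_apply, ContinuousLinearMap.comp_apply, map_add, h1,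
          one_apply_eq_self]
        rw [← h3]
        abel
      inv_val := by
        rw [← sub_sub, ← hW]
        ext x
        have h3 := congrArg R (congrArg X (hG' (Y x)))
        simp only [mul_apply_eq_comp, add_apply,
          sub_apply, ContinuousLinearMap.comp_apply, map_sub, h2,
          one_apply_eq_self] at h3 ⊢
        rw [sub_eq_iff_eq_add.1 h3]
        abel }
  exact ⟨u.isUnit, Ring.inverse_unit u⟩

/-- The matrix `1 - Y (z - M)⁻¹ X` whose determinant detects the spectrum of `M + X Y`. -/
def detMatrix {n : ℕ} (M : E →L[ℂ] E) (X : (Fin n → ℂ) →L[ℂ] E) (Y : E →L[ℂ] (Fin n → ℂ))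
    (z : ℂ) : Matrix (Fin n) (Fin n) ℂ :=
  Matrix.of fun i j => (1 : Matrix (Fin n) (Fin n) ℂ) i j - Y (resolvent M z (X (Pi.single j 1))) i

lemma detMatrix_mulVec {n : ℕ} (M : E →L[ℂ] E) (X : (Fin n → ℂ) →L[ℂ] E)
    (Y : E →L[ℂ] (Fin n → ℂ)) (z : ℂ) (v : Fin n → ℂ) :
    (detMatrix M X Y z).mulVec v = v - Y (resolvent M z (X v)) := by
  have h : detMatrix M X Y z = LinearMap.toMatrix' (LinearMap.id -
      ((Y ∘L resolvent M z ∘L X : (Fin n → ℂ) →L[ℂ] (Fin n → ℂ)) :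
        (Fin n → ℂ) →ₗ[ℂ] (Fin n → ℂ))) := by
    ext i j
    simp [detMatrix, LinearMap.toMatrix'_apply, Matrix.one_apply, Pi.single_apply]
  rw [h, LinearMap.toMatrix'_mulVec]
  rfl

lemma differentiableOn_resolvent [CompleteSpace E] (M : E →L[ℂ] E) :
    DifferentiableOn ℂ (resolvent M) (resolventSet ℂ M) := fun _ hz =>
  (spectrum.hasDerivAt_resolvent_const_left hz).differentiableAt.differentiableWithinAt

lemma differentiableOn_det {n : ℕ} {A : ℂ → Matrix (Fin n) (Fin n) ℂ} {s : Set ℂ}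
    (hA : ∀ i j, DifferentiableOn ℂ (fun z => A z i j) s) :
    DifferentiableOn ℂ (fun z => (A z).det) s := by
  simp only [Matrix.det_apply]
  refine DifferentiableOn.fun_sum fun σ _ => DifferentiableOn.const_smul ?_ _
  exact DifferentiableOn.fun_finsetProd fun i _ => hA _ _

lemma differentiableOn_adjugate {n : ℕ} {A : ℂ → Matrix (Fin n) (Fin n) ℂ} {s : Set ℂ}
    (hA : ∀ i j, DifferentiableOn ℂ (fun z => A z i j) s) (i j : Fin n) :
    DifferentiableOn ℂ (fun z => (A z).adjugate i j) s := by
  simp only [Matrix.adjugate_apply]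
  refine differentiableOn_det fun k l => ?_
  by_cases h : k = j
  · subst h; simp
  · simpa [Matrix.updateRow_ne h] using hA k l

lemma differentiableOn_detMatrix [CompleteSpace E] {n : ℕ} (M : E →L[ℂ] E) (X : (Fin n → ℂ) →L[ℂ] E)
    (Y : E →L[ℂ] (Fin n → ℂ)) (i j : Fin n) :
    DifferentiableOn ℂ (fun z => detMatrix M X Y z i j) (resolventSet ℂ M) := by
  let L : (E →L[ℂ] E) →L[ℂ] ℂ := (ContinuousLinearMap.proj i ∘L Y) ∘L
    ContinuousLinearMap.apply ℂ E (X (Pi.single j 1))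
  have h : DifferentiableOn ℂ (fun z => L (resolvent M z)) (resolventSet ℂ M) :=
    L.differentiable.comp_differentiableOn (differentiableOn_resolvent M)
  exact h.const_sub ((1 : Matrix (Fin n) (Fin n) ℂ) i j)

/-- The linear map of a matrix, as a bounded operator. -/
def matrixOp {n : ℕ} : Matrix (Fin n) (Fin n) ℂ →ₗ[ℂ] ((Fin n → ℂ) →L[ℂ] (Fin n → ℂ)) :=
  (LinearMap.toContinuousLinearMap : ((Fin n → ℂ) →ₗ[ℂ] (Fin n → ℂ)) ≃ₗ[ℂ] _).toLinearMap ∘ₗ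
    (Matrix.toLin' : Matrix (Fin n) (Fin n) ℂ ≃ₗ[ℂ] _).toLinearMap

lemma matrixOp_apply {n : ℕ} (A : Matrix (Fin n) (Fin n) ℂ) (v : Fin n → ℂ) :
    matrixOp A v = A.mulVec v := rfl

lemma differentiableOn_matrixOp {n : ℕ} {A : ℂ → Matrix (Fin n) (Fin n) ℂ} {s : Set ℂ}
    (hA : ∀ i j, DifferentiableOn ℂ (fun z => A z i j) s) :
    DifferentiableOn ℂ (fun z => matrixOp (A z)) s := by
  have h : ∀ z, matrixOp (A z) = ∑ i, ∑ j, A z i j • matrixOp (Matrix.single i j (1 : ℂ)) := by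
    intro z
    conv_lhs => rw [Matrix.matrix_eq_sum_single (A z)]
    simp only [map_sum, ← map_smul, Matrix.smul_single, smul_eq_mul, mul_one]
  simp only [h]
  exact DifferentiableOn.fun_sum fun i _ => DifferentiableOn.fun_sum fun j _ =>
    (hA i j).smul_const _

/-- Cramer's rule: with the inverse written as adjugate over determinant, the only factor that can
be singular on the resolvent set of `M` is 1/det. -/
lemma resolvent_of_det_ne_zero {n : ℕ} (M : E →L[ℂ] E) (X : (Fin n → ℂ) →L[ℂ] E)
    (Y : E →L[ℂ] (Fin n → ℂ)) {z : ℂ} (hz : z ∈ resolventSet ℂ M)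
    (hd : (detMatrix M X Y z).det ≠ 0) :
    z ∈ resolventSet ℂ (M + X ∘L Y) ∧ resolvent (M + X ∘L Y) z =
      resolvent M z + (resolvent M z ∘L X) ∘L
        (((detMatrix M X Y z).det⁻¹ • matrixOp (detMatrix M X Y z).adjugate) ∘L
          (Y ∘L resolvent M z)) := by
  refine resolvent_add_comp M X Y hz _ (fun v => ?_) fun v => ?_
  · rw [← detMatrix_mulVec, smul_apply, matrixOp_apply, Matrix.mulVec_smul,
      Matrix.mulVec_mulVec, Matrix.mul_adjugate, Matrix.smul_mulVec, Matrix.one_mulVec,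
      smul_smul, inv_mul_cancel₀ hd, one_smul]
  · rw [← detMatrix_mulVec, smul_apply, matrixOp_apply,
      Matrix.mulVec_mulVec, Matrix.adjugate_mul, Matrix.smul_mulVec, Matrix.one_mulVec,
      smul_smul, inv_mul_cancel₀ hd, one_smul]

/-- A kernel vector satisfies v = Y(z - M)⁻¹X v, and the eigenvector is (z - M)⁻¹X v. It is nonzero
because `Y` sends it to v ≠ 0. -/
lemma hasEigenvalue_of_det_eq_zero {n : ℕ} (M : E →L[ℂ] E) (X : (Fin n → ℂ) →L[ℂ] E)
    (Y : E →L[ℂ] (Fin n → ℂ)) {z : ℂ} (hz : z ∈ resolventSet ℂ M)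
    (hd : (detMatrix M X Y z).det = 0) :
    Module.End.HasEigenvalue ((M + X ∘L Y : E →L[ℂ] E) : E →ₗ[ℂ] E) z := by
  obtain ⟨v, hv, hNv⟩ := Matrix.exists_mulVec_eq_zero_iff.2 hd
  rw [detMatrix_mulVec, sub_eq_zero] at hNv
  have h1 : algebraMap ℂ (E →L[ℂ] E) z (resolvent M z (X v)) - M (resolvent M z (X v)) = X v :=
    congrArg (fun T : E →L[ℂ] E => T (X v)) (Ring.mul_inverse_cancel _ hz)
  refine Module.End.hasEigenvalue_of_hasEigenvector (x := resolvent M z (X v)) ⟨?_, fun h => ?_⟩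
  · rw [Module.End.mem_eigenspace_iff]
    change M (resolvent M z (X v)) + X (Y (resolvent M z (X v))) = z • resolvent M z (X v)
    rw [← hNv]
    nth_rw 2 [← h1]
    rw [Algebra.algebraMap_eq_smul_one, smul_apply, one_apply_eq_self]
    abel
  · rw [h, map_zero] at hNv
    exact hv hNv

lemma mem_spectrum_of_hasEigenvalue {A : E →L[ℂ] E} {z : ℂ}
    (h : Module.End.HasEigenvalue (A : E →ₗ[ℂ] E) z) : z ∈ spectrum ℂ A := by
  intro hu
  obtain ⟨v, hv⟩ := h.exists_hasEigenvector
  have h1 : (algebraMap ℂ (E →L[ℂ] E) z - A) v = 0 := by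
    have h2 : A v = z • v := hv.apply_eq_smul
    rw [sub_apply, h2, Algebra.algebraMap_eq_smul_one, smul_apply, one_apply_eq_self, sub_self]
  have h3 := congrArg (fun T : E →L[ℂ] E => T v) (Ring.inverse_mul_cancel _ hu)
  simp only [mul_apply_eq_comp, h1, map_zero, one_apply_eq_self] at h3
  exact hv.2 h3.symm

variable [CompleteSpace E]

/-- The determinant is holomorphic near `c`: it vanishes on a neighbourhood or to a finite order m
at `c` (m = 0 if `c` is not in the spectrum of `A`). In the second case the resolvent of `A` is a
holomorphic term plus (z - c)⁻ᵐ times a product of holomorphic families through ℂⁿ, whose circle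
integral has finite rank. -/
lemma finiteRank_perturbation (M A : E →L[ℂ] E) (hA : A - M ∈ finiteRank E E) {c : ℂ}
    (hc : c ∈ resolventSet ℂ M) :
    (c ∈ spectrum ℂ A → Module.End.HasEigenvalue (A : E →ₗ[ℂ] E) c) ∧
    ((∀ᶠ z in 𝓝 c, z ∈ spectrum ℂ A) ∨
      ((∀ᶠ z in 𝓝[≠] c, z ∉ spectrum ℂ A) ∧ HasFiniteAlgMultiplicity A c)) := by
  obtain ⟨n, X, Y, hXY⟩ := exists_factor hA
  obtain rfl : A = M + X ∘L Y := by rw [← hXY]; abel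
  have hU : IsOpen (resolventSet ℂ M) := spectrum.isOpen_resolventSet M
  have hUc := hU.mem_nhds hc
  set d : ℂ → ℂ := fun z => (detMatrix M X Y z).det with hd
  have hD := differentiableOn_detMatrix M X Y
  have hdd : DifferentiableOn ℂ d (resolventSet ℂ M) := differentiableOn_det hD
  have hmem : ∀ z ∈ resolventSet ℂ M, z ∈ spectrum ℂ (M + X ∘L Y) → d z = 0 := by
    intro z hz hzs
    by_contra h
    exact hzs (resolvent_of_det_ne_zero M X Y hz h).1
  have hspec : ∀ z ∈ resolventSet ℂ M, d z = 0 → z ∈ spectrum ℂ (M + X ∘L Y) := fun z hz h =>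
    mem_spectrum_of_hasEigenvalue (hasEigenvalue_of_det_eq_zero M X Y hz h)
  refine ⟨fun h => hasEigenvalue_of_det_eq_zero M X Y hc (hmem c hc h), ?_⟩
  have hda : AnalyticAt ℂ d c := hdd.analyticAt hUc
  by_cases hz0 : ∀ᶠ z in 𝓝 c, d z = 0
  · left
    filter_upwards [hz0, hUc] with z h1 h2 using hspec z h2 h1
  right
  obtain ⟨m, g, hg, hgc, hdg⟩ := hda.exists_eventuallyEq_pow_smul_nonzero_iff.2 hz0
  have hev : ∀ᶠ z in 𝓝 c, z ∈ resolventSet ℂ M ∧ DifferentiableAt ℂ g z ∧ g z ≠ 0 ∧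
      d z = (z - c) ^ m • g z := by
    filter_upwards [hUc, hg.eventually_analyticAt, hg.continuousAt.eventually_ne hgc, hdg]
      with z h1 h2 h3 h4 using ⟨h1, h2.differentiableAt, h3, h4⟩
  obtain ⟨V, hV, hVo, hcV⟩ := eventually_nhds_iff.1 hev
  have hne : ∀ z ∈ V, z ≠ c → d z ≠ 0 := fun z hz hzc => by
    rw [(hV z hz).2.2.2]
    exact smul_ne_zero (pow_ne_zero _ (sub_ne_zero.2 hzc)) (hV z hz).2.2.1
  have hns : ∀ z ∈ V, z ≠ c → z ∉ spectrum ℂ (M + X ∘L Y) := fun z hz hzc hs =>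
    hne z hz hzc (hmem z (hV z hz).1 hs)
  refine ⟨?_, ?_⟩
  · rw [eventually_nhdsWithin_iff]
    filter_upwards [hVo.mem_nhds hcV] with z hz hzc using hns z hz hzc
  obtain ⟨r, hr, hrV⟩ := Metric.nhds_basis_closedBall.mem_iff.1 (hVo.mem_nhds hcV)
  refine ⟨r, hr, fun z hz => ?_, ?_⟩
  · by_contra h
    exact hns z (hrV hz.1) h hz.2
  rw [← mem_finiteRank, rieszProj]
  refine Submodule.smul_mem _ _ ?_
  have hVU : V ⊆ resolventSet ℂ M := fun z hz => (hV z hz).1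
  have hR := (differentiableOn_resolvent M).mono hVU
  have hgd : DifferentiableOn ℂ g V := fun z hz => (hV z hz).2.1.differentiableWithinAt
  have hgi : DifferentiableOn ℂ (fun z => (g z)⁻¹) V := hgd.inv fun z hz => (hV z hz).2.2.1
  have hadj : DifferentiableOn ℂ (fun z => matrixOp (detMatrix M X Y z).adjugate) V :=
    differentiableOn_matrixOp fun i j =>
      (differentiableOn_adjugate hD i j).mono hVU
  have hYd : DifferentiableOn ℂ (fun z => ((g z)⁻¹ • matrixOp (detMatrix M X Y z).adjugate) ∘L
      (Y ∘L resolvent M z)) V :=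
    (hgi.smul hadj).clm_comp ((differentiableOn_const Y).clm_comp hR)
  have hXd : DifferentiableOn ℂ (fun z => resolvent M z ∘L X) V :=
    hR.clm_comp (differentiableOn_const X)
  have hsph : Metric.sphere c r ⊆ V := Metric.sphere_subset_closedBall.trans hrV
  have hsc : ∀ z ∈ Metric.sphere c r, z ≠ c := fun z hz h => by
    rw [h] at hz; simp at hz; exact hr.ne hz
  have hcongr : circleIntegral (fun z => resolvent (M + X ∘L Y) z) c r =
      circleIntegral (fun z => resolvent M z + ((z - c) ^ m)⁻¹ • ((resolvent M z ∘L X) ∘L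
        (((g z)⁻¹ • matrixOp (detMatrix M X Y z).adjugate) ∘L (Y ∘L resolvent M z)))) c r := by
    refine circleIntegral.integral_congr hr.le fun z hz => ?_
    have hzV := hsph hz
    have h4 : (detMatrix M X Y z).det = (z - c) ^ m • g z := (hV z hzV).2.2.2
    rw [(resolvent_of_det_ne_zero M X Y (hVU hzV) (hne z hzV (hsc z hz))).2, h4, smul_eq_mul,
      mul_inv, mul_smul]
    simp only [ContinuousLinearMap.smul_comp, ContinuousLinearMap.comp_smul]
  have hpow : ContinuousOn (fun z : ℂ => ((z - c) ^ m)⁻¹) (Metric.sphere c r) :=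
    ContinuousOn.inv₀ (by fun_prop) fun z hz => pow_ne_zero _ (sub_ne_zero.2 (hsc z hz))
  rw [hcongr, circleIntegral.integral_add
    ((hR.continuousOn.mono hsph).circleIntegrable hr.le)
    (ContinuousOn.circleIntegrable hr.le
      (hpow.fun_smul ((hXd.clm_comp hYd).continuousOn.mono hsph)))]
  have h0 : circleIntegral (fun z => resolvent M z) c r = 0 :=
    Complex.circleIntegral_eq_zero_of_differentiable_on_off_countable hr.le
      Set.countable_empty (hR.continuousOn.mono hrV) fun z hz =>
        hR.differentiableAt (hVo.mem_nhds (hrV (Metric.ball_subset_closedBall hz.1)))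
  rw [h0, zero_add]
  exact circleIntegral_pole_mem_finiteRank hr hVo hrV hYd m hXd

/-- The local alternative at a point of the resolvent set of `M`, for `A` a compact
perturbation of `M`. -/
lemma approxOps_perturbation (M A : E →L[ℂ] E) (hA : A - M ∈ approxOps E) {c : ℂ}
    (hc : c ∈ resolventSet ℂ M) :
    (c ∈ spectrum ℂ A → Module.End.HasEigenvalue (A : E →ₗ[ℂ] E) c) ∧
    ((∀ᶠ z in 𝓝 c, z ∈ spectrum ℂ A) ∨
      ((∀ᶠ z in 𝓝[≠] c, z ∉ spectrum ℂ A) ∧ HasFiniteAlgMultiplicity A c)) := by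
  -- Invertibility is an open condition, so `A - M` may be replaced by a nearby finite-rank `G`, and
  -- `M` by `A - G`, with `c` still in the resolvent set.
  have hopen : IsOpen {G : E →L[ℂ] E | IsUnit (algebraMap ℂ (E →L[ℂ] E) c - (A - G))} :=
    Units.isOpen.preimage (by fun_prop)
  have hmem : A - M ∈ {G : E →L[ℂ] E | IsUnit (algebraMap ℂ (E →L[ℂ] E) c - (A - G))} := by
    simp only [Set.mem_ofPred_eq, sub_sub_cancel]
    exact hc
  obtain ⟨G, hG, hGF⟩ := mem_closure_iff.1 hA _ hopen hmem
  exact finiteRank_perturbation (A - G) A (by simpa using hGF) hG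

/-- **Analytic Fredholm theorem** for the resolvent of a compact perturbation. -/
theorem analytic_fredholm (M A : E →L[ℂ] E) (hA : A - M ∈ approxOps E) {U : Set ℂ}
    (hUc : IsPreconnected U) (hUM : U ⊆ resolventSet ℂ M)
    (hUA : (U \ spectrum ℂ A).Nonempty) :
    (∀ c ∈ U, c ∈ spectrum ℂ A →
      Module.End.HasEigenvalue (A : E →ₗ[ℂ] E) c ∧ HasFiniteAlgMultiplicity A c) ∧
    ∀ c ∈ U, ∀ᶠ z in 𝓝[≠] c, z ∉ spectrum ℂ A := by
  have hloc := fun c hc => approxOps_perturbation M A hA (hUM hc : c ∈ resolventSet ℂ M)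
  -- The interior of the spectrum is relatively closed in `U`, since the isolated alternative
  -- excludes boundary points. If it met `U` it would contain `U`, against `hUA`.
  have key : ∀ c ∈ U, ¬ ∀ᶠ z in 𝓝 c, z ∈ spectrum ℂ A := by
    intro c hc hcs
    obtain ⟨w, hwU, hws⟩ := hUA
    refine hws (interior_subset (hUc.subset_of_closure_inter_subset isOpen_interior
      ⟨c, hc, mem_interior_iff_mem_nhds.2 hcs⟩ ?_ hwU))
    rintro x ⟨hx, hxU⟩
    rcases (hloc x hxU).2 with h | h
    · exact mem_interior_iff_mem_nhds.2 h
    · by_contra hxn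
      refine mem_closure_iff_frequently.1 hx ?_
      filter_upwards [eventually_nhdsWithin_iff.1 h.1] with z hz hzi
      exact hz (fun hzx => hxn (hzx ▸ hzi)) (interior_subset hzi)
  refine ⟨fun c hc hcs => ⟨(hloc c hc).1 hcs, ?_⟩, fun c hc => ?_⟩
  · exact ((hloc c hc).2.resolve_left (key c hc)).2
  · exact ((hloc c hc).2.resolve_left (key c hc)).1

end Local

/-! ### Linear equations in a Banach algebra by the Dyson series -/

section LinearODE

variable {𝔸 : Type*} [NormedRing 𝔸] [NormedAlgebra ℝ 𝔸]

/-- The terms of the Dyson series of `Φ' = A(t) Φ`, `Φ(0) = 1`. -/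
def dyson (A : ℝ → 𝔸) : ℕ → ℝ → 𝔸
  | 0 => fun _ => 1
  | n + 1 => fun t => ∫ s in (0 : ℝ)..t, A s * dyson A n s

lemma continuous_dyson {A : ℝ → 𝔸} (hA : Continuous A) (n : ℕ) : Continuous (dyson A n) := by
  induction n with
  | zero => exact continuous_const
  | succ n ih =>
    exact intervalIntegral.continuous_primitive (fun a b => (hA.mul ih).intervalIntegrable a b) 0

lemma hasDerivAt_dyson_succ [CompleteSpace 𝔸] {A : ℝ → 𝔸} (hA : Continuous A) (n : ℕ) (t : ℝ) :
    HasDerivAt (dyson A (n + 1)) (A t * dyson A n t) t :=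
  intervalIntegral.integral_hasDerivAt_right
    ((hA.mul (continuous_dyson hA n)).intervalIntegrable _ _)
    ((hA.mul (continuous_dyson hA n)).stronglyMeasurableAtFilter _ _)
    (hA.mul (continuous_dyson hA n)).continuousAt

/-- Iterated integration of the constant C produces the terms of the exponential series. The factor
‖1‖ remains because the unit is not assumed to have norm one. -/
lemma norm_dyson_le {A : ℝ → 𝔸} {C : ℝ} (hC : ∀ t, ‖A t‖ ≤ C) (n : ℕ)
    (t : ℝ) : ‖dyson A n t‖ ≤ ‖(1 : 𝔸)‖ * ((C * |t|) ^ n / n.factorial) := by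
  have hC0 : 0 ≤ C := (norm_nonneg _).trans (hC 0)
  induction n generalizing t with
  | zero => simp [dyson]
  | succ n ih =>
    have hb : ∀ s, ‖A s * dyson A n s‖ ≤ C * (‖(1 : 𝔸)‖ * ((C * |s|) ^ n / n.factorial)) :=
      fun s => (norm_mul_le _ _).trans (mul_le_mul (hC s) (ih s) (norm_nonneg _) hC0)
    have hint : ∀ {u : ℝ}, 0 ≤ u → ∫ s in (0 : ℝ)..u, C * (‖(1 : 𝔸)‖ * ((C * s) ^ n / n.factorial))
        = ‖(1 : 𝔸)‖ * ((C * u) ^ (n + 1) / (n + 1).factorial) := by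
      intro u _
      have : ∀ s : ℝ, C * (‖(1 : 𝔸)‖ * ((C * s) ^ n / n.factorial)) =
          (C ^ (n + 1) * ‖(1 : 𝔸)‖ / n.factorial) * s ^ n := fun s => by
        rw [mul_pow, pow_succ]; ring
      simp only [this]
      rw [intervalIntegral.integral_const_mul, integral_pow, Nat.factorial_succ]
      push_cast
      have h1 : (n.factorial : ℝ) ≠ 0 := by positivity
      have h2 : (n : ℝ) + 1 ≠ 0 := by positivity
      field_simp
      rw [zero_pow n.succ_ne_zero]
      ring
    rcases le_total 0 t with ht | ht
    · rw [abs_of_nonneg ht, ← hint ht]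
      refine intervalIntegral.norm_integral_le_of_norm_le ht ?_ (by
        apply Continuous.intervalIntegrable; fun_prop)
      refine Eventually.of_forall fun s hs => ?_
      have := hb s
      rwa [abs_of_pos hs.1] at this
    · rw [abs_of_nonpos ht, ← hint (neg_nonneg.2 ht)]
      -- The reflection s ↦ -s reduces negative times to the integral already computed.
      have h := intervalIntegral.integral_comp_neg (a := t) (b := 0)
        (fun s => C * (‖(1 : 𝔸)‖ * ((C * s) ^ n / n.factorial)))
      rw [neg_zero] at h
      rw [← h]
      change ‖∫ s in (0 : ℝ)..t, A s * dyson A n s‖ ≤ _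
      rw [intervalIntegral.integral_symm, norm_neg]
      refine intervalIntegral.norm_integral_le_of_norm_le ht ?_ (by
        apply Continuous.intervalIntegrable; fun_prop)
      refine Eventually.of_forall fun s hs => ?_
      have := hb s
      rwa [abs_of_nonpos hs.2] at this

/-- Existence for the linear equation `Φ' = A(t) Φ`, `Φ(0) = 1`, in a Banach algebra. -/
theorem exists_fundamental [CompleteSpace 𝔸] {A : ℝ → 𝔸} (hA : Continuous A)
    {C : ℝ} (hC : ∀ t, ‖A t‖ ≤ C) :
    ∃ Φ : ℝ → 𝔸, Φ 0 = 1 ∧ ∀ t, HasDerivAt Φ (A t * Φ t) t := by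
  have hC0 : 0 ≤ C := (norm_nonneg _).trans (hC 0)
  have hsum : ∀ t, Summable fun n => dyson A n t := fun t =>
    Summable.of_norm_bounded ((Real.summable_pow_div_factorial (C * |t|)).mul_left _)
      fun n => norm_dyson_le hC n t
  refine ⟨fun t => ∑' n, dyson A n t, ?_, fun t => ?_⟩
  · beta_reduce
    rw [tsum_eq_single 0]
    · rfl
    · rintro (_ | n) hn
      · exact absurd rfl hn
      · simp [dyson]
  -- On this ball the terms have a summable bound independent of time, which permits termwise
  -- differentiation at `t`.
  have hT : t ∈ Metric.ball (0 : ℝ) (|t| + 1) := by simp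
  have h := hasDerivAt_tsum_of_isPreconnected (t := Metric.ball (0 : ℝ) (|t| + 1))
    (g := fun n t => dyson A (n + 1) t) (g' := fun n t => A t * dyson A n t)
    (u := fun n => C * (‖(1 : 𝔸)‖ * ((C * (|t| + 1)) ^ n / n.factorial)))
    (((Real.summable_pow_div_factorial (C * (|t| + 1))).mul_left _).mul_left _)
    Metric.isOpen_ball (convex_ball _ _).isPreconnected
    (fun n y _ => hasDerivAt_dyson_succ hA n y) (fun n y hy => ?_) hT
    ((summable_nat_add_iff 1).2 (hsum t)) hT
  · have heq : (fun t => ∑' n, dyson A n t) = fun t => 1 + ∑' n, dyson A (n + 1) t := by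
      funext s
      rw [(hsum s).tsum_eq_zero_add]
      rfl
    rw [heq]
    have h2 : A t * ∑' n, dyson A n t = ∑' n, A t * dyson A n t := ((hsum t).tsum_mul_left _).symm
    beta_reduce
    rw [show (1 : 𝔸) + ∑' n, dyson A (n + 1) t = ∑' n, dyson A n t from (congrFun heq t).symm, h2]
    exact h.const_add 1
  · refine (norm_mul_le _ _).trans (mul_le_mul (hC y) ((norm_dyson_le hC n y).trans ?_)
      (norm_nonneg _) hC0)
    have hy' : |y| ≤ |t| + 1 := by simpa using (Metric.mem_ball.1 hy).le
    gcongr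

end LinearODE

/-! ### Variation of constants modulo the ideal -/

section Duhamel

variable {E : Type*} [NormedAddCommGroup E] [NormedSpace ℂ E] [CompleteSpace E]

/-- A curve whose velocity lies in a closed subspace stays in a coset of it. -/
lemma sub_mem_of_hasDerivAt {V : Type*} [NormedAddCommGroup V] [NormedSpace ℝ V]
    (S : Submodule ℝ V) (hS : IsClosed (S : Set V)) {D D' : ℝ → V}
    (hD : ∀ t, HasDerivAt D (D' t) t) (hD' : ∀ t, D' t ∈ S) (t₀ t₁ : ℝ) : D t₀ - D t₁ ∈ S := by
  -- In the quotient by the closed subspace `S` the curve has zero velocity, hence is constant.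
  have hqD : ∀ t, HasDerivAt (fun t => S.mkQL (D t)) 0 t := by
    intro t
    have h0 : S.mkQL (D' t) = 0 := (Submodule.Quotient.mk_eq_zero _).2 (hD' t)
    rw [← h0]
    exact S.mkQL.hasFDerivAt.comp_hasDerivAt t (hD t)
  have h : S.mkQL (D t₀) = S.mkQL (D t₁) :=
    is_const_of_deriv_eq_zero (fun t => (hqD t).differentiableAt) (fun t => (hqD t).deriv) t₀ t₁
  exact (Submodule.Quotient.mk_eq_zero _).1 ((map_sub S.mkQL _ _).trans (sub_eq_zero.2 h))

/-- A compact perturbation of the generator changes the time-`t` map by a compact operator. -/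
lemma sub_exp_mem_approxOps (A₀ : E →L[ℂ] E) {K Φ : ℝ → E →L[ℂ] E}
    (hK : ∀ t, K t ∈ approxOps E) (hΦ0 : Φ 0 = 1)
    (hΦ : ∀ t, HasDerivAt Φ ((A₀ + K t) * Φ t) t) (t : ℝ) :
    Φ t - NormedSpace.exp ((t : ℂ) • A₀) ∈ approxOps E := by
  rw [Complex.coe_smul]
  have hcl : IsClosed (approxOps E : Set (E →L[ℂ] E)) := isClosed_approxOps
  -- Interaction picture: the `A₀` terms cancel in the derivative, leaving a product with the factor
  -- `K t`, which lies in the ideal.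
  let D : ℝ → E →L[ℂ] E := fun t => NormedSpace.exp (t • (-A₀)) * Φ t
  have hD : ∀ t, HasDerivAt D (NormedSpace.exp (t • (-A₀)) * (K t * Φ t)) t := by
    intro t
    have h1 := (hasDerivAt_exp_smul_const (𝕂 := ℝ) (-A₀) t).mul (hΦ t)
    refine h1.congr_deriv ?_
    simp only [mul_assoc, add_mul, mul_add, neg_mul, mul_neg]
    abel
  have hD0 : D 0 = 1 := by simp [D, hΦ0]
  have hmem : D t - 1 ∈ approxOps E := by
    rw [← hD0]
    exact sub_mem_of_hasDerivAt ((approxOps E).restrictScalars ℝ) hcl hD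
      (fun t => mul_mem_approxOps_left _ (mul_mem_approxOps_right _ (hK t))) t 0
  have hfin := mul_mem_approxOps_left (NormedSpace.exp (t • A₀)) hmem
  convert hfin using 1
  have hinv : NormedSpace.exp (t • A₀) * NormedSpace.exp (t • (-A₀)) = 1 := by
    let _ : NormedAlgebra ℚ (E →L[ℂ] E) := NormedAlgebra.restrictScalars ℚ ℂ (E →L[ℂ] E)
    rw [smul_neg, ← NormedSpace.exp_add_of_commute (Commute.refl (t • A₀)).neg_right,
      add_neg_cancel, NormedSpace.exp_zero]
  rw [mul_sub, ← mul_assoc, hinv, one_mul, mul_one]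

/-- The solution operators of `u' = (A₀ + K(t)) u`, with `K(t)` compact. -/
theorem exists_solutionOp (A₀ : E →L[ℂ] E) {K : ℝ → E →L[ℂ] E} (hKc : Continuous K)
    (hK : ∀ t, K t ∈ approxOps E) {C : ℝ} (hC : ∀ t, ‖A₀ + K t‖ ≤ C) :
    ∃ Φ : ℝ → E →L[ℂ] E, (∀ u, Φ 0 u = u) ∧
      (∀ u t, HasDerivAt (fun t => Φ t u) ((A₀ + K t) (Φ t u)) t) ∧
      ∀ t : ℝ, Φ t - NormedSpace.exp ((t : ℂ) • A₀) ∈ approxOps E := by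
  obtain ⟨Φ, hΦ0, hΦ⟩ := exists_fundamental (A := fun t => A₀ + K t)
    (continuous_const.add hKc) hC
  refine ⟨Φ, fun u => by rw [hΦ0]; rfl, fun u t => ?_, sub_exp_mem_approxOps _ hK hΦ0 hΦ⟩
  exact ((ContinuousLinearMap.apply ℂ E u).restrictScalars ℝ).hasFDerivAt.comp_hasDerivAt
    t (hΦ t)

end Duhamel

/-! ### Characters detecting the spectrum of an exponential -/

section Gelfand

variable {𝔸 : Type*} [NormedRing 𝔸] [NormedAlgebra ℂ 𝔸] [CompleteSpace 𝔸]

/-- In a closed commutative subalgebra, an element without inverse in the ambient algebra is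
annihilated by a character. -/
lemma exists_character (B : Subalgebra ℂ 𝔸) (hB : IsClosed (B : Set 𝔸))
    (hcomm : ∀ x ∈ B, ∀ y ∈ B, x * y = y * x) (x : B) (hx : ¬ IsUnit (x : 𝔸)) :
    ∃ f : B →ₐ[ℂ] ℂ, f x = 0 ∧ Continuous f ∧ ∀ y : B, ‖f y‖ ≤ ‖(y : 𝔸)‖ * ‖(1 : 𝔸)‖ := by
  let _ : NormedCommRing B :=
    { (inferInstance : NormedRing B) with
      mul_comm := fun x y => Subtype.ext (hcomm x x.2 y y.2) }
  have : CompleteSpace B := hB.completeSpace_coe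
  have hxB : ¬ IsUnit x := fun h => hx (h.map B.val)
  obtain ⟨f, hf⟩ := WeakDual.CharacterSpace.exists_apply_eq_zero hxB
  exact ⟨WeakDual.CharacterSpace.toAlgHom f, hf, map_continuous f,
    fun y => AlgHom.norm_apply_le_self_mul_norm_one f y⟩

/-- If `z - exp A` has no inverse, then on the bicommutant of a commuting set containing `A` there
is a character sending `exp A` to `z`. -/
lemma exists_character_exp {s : Set 𝔸} (hs : ∀ x ∈ s, ∀ y ∈ s, x * y = y * x) {A : 𝔸}
    (hA : A ∈ s) {z : ℂ} (hz : z ∈ spectrum ℂ (NormedSpace.exp A)) :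
    ∃ f : Subalgebra.centralizer ℂ (Set.centralizer s) →ₐ[ℂ] ℂ,
      Complex.exp (f ⟨A, Set.subset_centralizer_centralizer hA⟩) = z ∧
      ∀ y, ‖f y‖ ≤ ‖(y : 𝔸)‖ * ‖(1 : 𝔸)‖ := by
  set B := Subalgebra.centralizer ℂ (Set.centralizer s) with hBdef
  have hBc : IsClosed (B : Set 𝔸) := Set.isClosed_centralizer _
  have hcomm : ∀ x ∈ B, ∀ y ∈ B, x * y = y * x := by
    intro x hx y hy
    exact Set.centralizer_centralizer_comm_of_comm hs x hx y hy
  have : CompleteSpace B := hBc.completeSpace_coe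
  let a : B := ⟨A, Set.subset_centralizer_centralizer hA⟩
  have hval : ((NormedSpace.exp a : B) : 𝔸) = NormedSpace.exp A :=
    NormedSpace.map_exp_of_mem_ball (𝕂 := ℂ) B.val continuous_subtype_val a
      ((NormedSpace.expSeries_radius_eq_top ℂ B).symm ▸ edist_lt_top _ _)
  obtain ⟨f, hf, hfc, hfn⟩ := exists_character B hBc hcomm
    (algebraMap ℂ B z - NormedSpace.exp a) (by
    rw [AddSubgroupClass.coe_sub, hval]
    exact hz)
  refine ⟨f, ?_, hfn⟩
  rw [map_sub, AlgHom.commutes, sub_eq_zero] at hf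
  have := NormedSpace.map_exp_of_mem_ball (𝕂 := ℂ) f hfc a
      ((NormedSpace.expSeries_radius_eq_top ℂ B).symm ▸ edist_lt_top _ _)
  rw [Complex.exp_eq_exp_ℂ, ← this, ← hf]
  rfl

end Gelfand

/-! ### Shifts and multiplication operators on H_ρ -/

section Operators

variable {ρ : ℝ}

@[ext] lemma Hsp.ext {u v : Hsp ρ} (h : ∀ j, u j = v j) : u = v := Subtype.ext (funext h)

@[simp] lemma Hsp.add_apply (u v : Hsp ρ) (j : ℤ) : (u + v) j = u j + v j := rfl
@[simp] lemma Hsp.sub_apply (u v : Hsp ρ) (j : ℤ) : (u - v) j = u j - v j := rfl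
@[simp] lemma Hsp.neg_apply (u : Hsp ρ) (j : ℤ) : (-u) j = -u j := rfl
@[simp] lemma Hsp.smul_apply (c : ℂ) (u : Hsp ρ) (j : ℤ) : (c • u) j = c * u j := rfl
@[simp] lemma Hsp.zero_apply (j : ℤ) : (0 : Hsp ρ) j = 0 := rfl

lemma Hsp.summable (v : Hsp ρ) : Summable fun j => weight ρ j * ‖v j‖ ^ 2 := v.2

section Dominated

variable (T : (ℤ → ℂ) →ₗ[ℂ] (ℤ → ℂ)) (C : ℝ) (e : ℤ ≃ ℤ)

lemma summable_dominated (v : Hsp ρ) :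
    Summable fun j => C ^ 2 * (weight ρ (e j) * ‖v (e j)‖ ^ 2) :=
  ((e.summable_iff (f := fun j => weight ρ j * ‖v j‖ ^ 2)).2 v.summable).mul_left _

/-- A linear map on sequences which is dominated, entry by entry, by a permutation of the
entries maps `H_ρ` to itself. -/
def dominatedLin
    (h : ∀ v j, weight ρ j * ‖T v j‖ ^ 2 ≤ C ^ 2 * (weight ρ (e j) * ‖v (e j)‖ ^ 2)) :
    Hsp ρ →ₗ[ℂ] Hsp ρ where
  toFun v := (⟨T v, Summable.of_nonneg_of_le
      (fun j => mul_nonneg (weight_pos ρ j).le (sq_nonneg _))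
      (fun j => h v j) (summable_dominated C e v)⟩ : weightedL2 ρ)
  map_add' u v := Subtype.ext (T.map_add u.1 v.1)
  map_smul' c v := Subtype.ext (T.map_smul c v.1)

lemma norm_dominatedLin_le (hC : 0 ≤ C)
    (h : ∀ v j, weight ρ j * ‖T v j‖ ^ 2 ≤ C ^ 2 * (weight ρ (e j) * ‖v (e j)‖ ^ 2))
    (v : Hsp ρ) : ‖dominatedLin T C e h v‖ ≤ C * ‖v‖ := by
  refine le_of_sq_le_sq ?_ (mul_nonneg hC (norm_nonneg _))
  rw [mul_pow, norm_sq_eq, norm_sq_eq,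
    ← e.tsum_eq (fun j => weight ρ j * ‖v j‖ ^ 2), ← tsum_mul_left]
  exact (dominatedLin T C e h v).summable.tsum_le_tsum (fun j => h v j) (summable_dominated C e v)

/-- The bounded operator on `H_ρ` given by a dominated linear map on sequences. -/
def ofBound (hC : 0 ≤ C)
    (h : ∀ v j, weight ρ j * ‖T v j‖ ^ 2 ≤ C ^ 2 * (weight ρ (e j) * ‖v (e j)‖ ^ 2)) :
    Hsp ρ →L[ℂ] Hsp ρ :=
  (dominatedLin T C e h).mkContinuous C (norm_dominatedLin_le T C e hC h)

lemma norm_ofBound_le (hC : 0 ≤ C)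
    (h : ∀ v j, weight ρ j * ‖T v j‖ ^ 2 ≤ C ^ 2 * (weight ρ (e j) * ‖v (e j)‖ ^ 2)) :
    ‖ofBound T C e hC h‖ ≤ C := LinearMap.mkContinuous_norm_le _ hC _

end Dominated

lemma cosh_add_le (x y : ℝ) : Real.cosh (x + y) ≤ Real.exp |y| * Real.cosh x := by
  have h1 : Real.exp y ≤ Real.exp |y| := Real.exp_le_exp.2 (le_abs_self y)
  have h2 : Real.exp (-y) ≤ Real.exp |y| := Real.exp_le_exp.2 (neg_le_abs y)
  rw [Real.cosh_eq, Real.cosh_eq, neg_add, Real.exp_add, Real.exp_add]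
  nlinarith [mul_le_mul_of_nonneg_left h1 (Real.exp_pos x).le,
    mul_le_mul_of_nonneg_left h2 (Real.exp_pos (-x)).le]

/-- The shift `(S_k v)_j = v_{j+k}`. -/
def shift (ρ : ℝ) (k : ℤ) : Hsp ρ →L[ℂ] Hsp ρ :=
  ofBound (LinearMap.funLeft ℂ ℂ fun j => j + k) (Real.exp |k * ρ|) (Equiv.addRight k)
    (Real.exp_pos _).le fun v j => by
    -- Shifting by k moves the argument of cosh by 2kρ, at a cost of e^{2|kρ|}; norms enter squared,
    -- so the operator bound is e^{|kρ|}.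
    have h := cosh_add_le (2 * ((j + k : ℤ) : ℝ) * ρ) (-(2 * (k * ρ)))
    have h1 : 2 * ((j + k : ℤ) : ℝ) * ρ + -(2 * (k * ρ)) = 2 * (j : ℝ) * ρ := by
      push_cast; ring
    have h2 : Real.exp |-(2 * (k * ρ))| = Real.exp |k * ρ| ^ 2 := by
      rw [abs_neg, abs_mul, abs_two, ← Real.exp_nat_mul]; norm_num
    rw [h1, h2] at h
    rw [← mul_assoc]
    exact mul_le_mul_of_nonneg_right h (sq_nonneg _)

@[simp] lemma shift_apply (k : ℤ) (v : Hsp ρ) (j : ℤ) : shift ρ k v j = v (j + k) := rfl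

lemma norm_shift_le (k : ℤ) : ‖shift ρ k‖ ≤ Real.exp |k * ρ| := norm_ofBound_le _ _ _ _ _

/-- Multiplication by a bounded sequence. -/
def mult (ρ : ℝ) (m : ℤ → ℂ) (C : ℝ) (hC : ∀ j, ‖m j‖ ≤ C) : Hsp ρ →L[ℂ] Hsp ρ :=
  ofBound (LinearMap.mulLeft ℂ m) C (Equiv.refl ℤ) ((norm_nonneg _).trans (hC 0)) fun v j => by
    change weight ρ j * ‖m j * v j‖ ^ 2 ≤ C ^ 2 * (weight ρ j * ‖v j‖ ^ 2)
    rw [norm_mul, mul_pow, mul_left_comm]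
    have := pow_le_pow_left₀ (norm_nonneg _) (hC j) 2
    exact mul_le_mul_of_nonneg_right this (mul_nonneg (weight_pos ρ j).le (sq_nonneg _))

@[simp] lemma mult_apply (m : ℤ → ℂ) (C : ℝ) (hC : ∀ j, ‖m j‖ ≤ C) (v : Hsp ρ) (j : ℤ) :
    mult ρ m C hC v j = m j * v j := rfl

lemma norm_mult_sub_le {m m' : ℤ → ℂ} {C C' D : ℝ} (hC : ∀ j, ‖m j‖ ≤ C) (hC' : ∀ j, ‖m' j‖ ≤ C')
    (hD : ∀ j, ‖m j - m' j‖ ≤ D) : ‖mult ρ m C hC - mult ρ m' C' hC'‖ ≤ D := by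
  have h : mult ρ m C hC - mult ρ m' C' hC' = mult ρ (fun j => m j - m' j) D hD := by
    ext v j
    simp [sub_mul]
  rw [h]
  exact norm_ofBound_le _ _ _ _ _

lemma mult_mem_finiteRank {m : ℤ → ℂ} {C : ℝ} (hC : ∀ j, ‖m j‖ ≤ C) (s : Finset ℤ)
    (hs : ∀ j ∉ s, m j = 0) : mult ρ m C hC ∈ finiteRank (Hsp ρ) (Hsp ρ) := by
  rw [mem_finiteRank]
  let L : LinearMap.range (mult ρ m C hC : Hsp ρ →ₗ[ℂ] Hsp ρ) →ₗ[ℂ] (s → ℂ) :=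
    { toFun := fun v j => v.1 j
      map_add' := fun _ _ => rfl
      map_smul' := fun _ _ => rfl }
  refine FiniteDimensional.of_injective L ?_
  rintro ⟨_, u, rfl⟩ ⟨_, v, rfl⟩ huv
  refine Subtype.ext (Hsp.ext fun j => ?_)
  by_cases hj : j ∈ s
  · exact congrFun huv ⟨j, hj⟩
  · change m j * u j = m j * v j
    simp [hs j hj]

/-- Truncating the sequence to a finite set gives finite rank, and the error in operator norm is at
most the supremum of the tail. -/
lemma mult_mem_approxOps {m : ℤ → ℂ} {C : ℝ} (hC : ∀ j, ‖m j‖ ≤ C)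
    (hm : ∀ ε > 0, ∃ s : Finset ℤ, ∀ j ∉ s, ‖m j‖ ≤ ε) : mult ρ m C hC ∈ approxOps (Hsp ρ) := by
  classical
  refine Metric.mem_closure_iff.2 fun ε hε => ?_
  obtain ⟨s, hs⟩ := hm (ε / 2) (half_pos hε)
  have hC' : ∀ j, ‖(if j ∈ s then m j else 0)‖ ≤ C := fun j => by
    split_ifs
    · exact hC j
    · simpa using (norm_nonneg _).trans (hC j)
  refine ⟨mult ρ (fun j => if j ∈ s then m j else 0) C hC',
    mult_mem_finiteRank hC' s fun j hj => if_neg hj, ?_⟩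
  rw [dist_eq_norm]
  refine (norm_mult_sub_le (D := ε / 2) hC hC' fun j => ?_).trans_lt (half_lt_self hε)
  by_cases hj : j ∈ s
  · simpa [hj] using (half_pos hε).le
  · simpa [hj] using hs j hj

/-- Tails small uniformly in t reduce norm continuity to finitely many coordinates. -/
lemma continuous_mult {m : ℝ → ℤ → ℂ} {C : ℝ} (hC : ∀ t j, ‖m t j‖ ≤ C)
    (hc : ∀ j, Continuous fun t => m t j)
    (hm : ∀ ε > 0, ∃ s : Finset ℤ, ∀ j ∉ s, ∀ t, ‖m t j‖ ≤ ε) :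
    Continuous fun t => mult ρ (m t) C (hC t) := by
  refine continuous_iff_continuousAt.2 fun t₀ => Metric.tendsto_nhds.2 fun ε hε => ?_
  obtain ⟨s, hs⟩ := hm (ε / 4) (by positivity)
  have hev : ∀ᶠ t in 𝓝 t₀, ∀ j ∈ s, ‖m t j - m t₀ j‖ < ε / 2 := by
    rw [Finset.eventually_all]
    intro j _
    have := Metric.tendsto_nhds.1 ((hc j).continuousAt (x := t₀)) (ε / 2) (half_pos hε)
    simpa [dist_eq_norm] using this
  filter_upwards [hev] with t ht
  rw [dist_eq_norm]
  refine (norm_mult_sub_le (D := ε / 2) (hC t) (hC t₀) fun j => ?_).trans_lt (half_lt_self hε)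
  by_cases hj : j ∈ s
  · exact (ht j hj).le
  · refine (norm_sub_le _ _).trans ?_
    linarith [hs j hj t, hs j hj t₀]

/-- This crude growth, from cosh 2x = 1 + 2 sinh² x and |sinh x| ≥ |x|, is enough to make the
coefficients decay in j. -/
lemma sq_mul_sq_le_weight (ρ : ℝ) (j : ℤ) : ρ ^ 2 * (j : ℝ) ^ 2 ≤ weight ρ j := by
  have h : 1 + (2 * (j : ℝ) * ρ) ^ 2 / 2 ≤ weight ρ j := by
    have h1 := Real.cosh_two_mul ((j : ℝ) * ρ)
    have h2 := Real.cosh_sq ((j : ℝ) * ρ)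
    have h3 : ((j : ℝ) * ρ) ^ 2 ≤ Real.sinh ((j : ℝ) * ρ) ^ 2 := by
      rw [sq_le_sq]
      rcases le_total 0 ((j : ℝ) * ρ) with h | h
      · rw [abs_of_nonneg h, abs_of_nonneg (Real.sinh_nonneg_iff.2 h)]
        exact Real.self_le_sinh_iff.2 h
      · rw [abs_of_nonpos h, abs_of_nonpos (Real.sinh_nonpos_iff.2 h)]
        exact neg_le_neg (Real.sinh_le_self_iff.2 h)
    rw [weight, mul_assoc, h1, h2]
    linarith
  nlinarith [sq_nonneg (ρ * j)]

lemma exists_finset_le {ρ₀ C : ℝ} (hρ₀ : 0 < ρ₀) {γ : ℤ → ℝ → ℝ}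
    (h : ∀ (t : ℝ) (j : ℤ), Real.sqrt (weight ρ₀ j) * |γ j t| ≤ C) {ε : ℝ} (hε : 0 < ε) :
    ∃ s : Finset ℤ, ∀ j ∉ s, ∀ t, ‖(γ j t : ℂ)‖ ≤ ε := by
  have hC : 0 ≤ C := le_trans (by positivity) (h 0 0)
  -- Beyond this N one has C ≤ ρ₀|j|ε, while √weight ≥ ρ₀|j|.
  obtain ⟨N, hN⟩ := exists_nat_ge (C / (ρ₀ * ε))
  refine ⟨Finset.Icc (-(N : ℤ)) N, fun j hj t => ?_⟩
  have hjN : (N : ℝ) ≤ |(j : ℝ)| := by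
    rw [Finset.mem_Icc, ← abs_le, not_le] at hj
    exact_mod_cast hj.le
  have hw : ρ₀ * |(j : ℝ)| ≤ Real.sqrt (weight ρ₀ j) := by
    refine Real.le_sqrt_of_sq_le ?_
    rw [mul_pow, sq_abs]
    exact sq_mul_sq_le_weight ρ₀ j
  rw [Complex.norm_real, Real.norm_eq_abs]
  by_contra hlt
  push Not at hlt
  have hj0 : 0 < |(j : ℝ)| := by
    rw [abs_pos]
    rintro h0
    apply hj
    have : j = 0 := by exact_mod_cast h0
    simp [this]
  have h1 : C ≤ ρ₀ * |(j : ℝ)| * ε := by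
    rw [div_le_iff₀ (by positivity)] at hN
    nlinarith [mul_le_mul_of_nonneg_right hjN (by positivity : 0 ≤ ρ₀ * ε)]
  have h2 : ρ₀ * |(j : ℝ)| * ε < ρ₀ * |(j : ℝ)| * |γ j t| :=
    mul_lt_mul_of_pos_left hlt (by positivity)
  have h3 := mul_le_mul_of_nonneg_right hw (abs_nonneg (γ j t))
  linarith [h t j]

lemma norm_le_of_decay {ρ₀ C : ℝ} {γ : ℤ → ℝ → ℝ}
    (h : ∀ (t : ℝ) (j : ℤ), Real.sqrt (weight ρ₀ j) * |γ j t| ≤ C) (t : ℝ) (j : ℤ) :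
    ‖(γ j t : ℂ)‖ ≤ C := by
  rw [Complex.norm_real, Real.norm_eq_abs]
  refine le_trans ?_ (h t j)
  have : 1 ≤ Real.sqrt (weight ρ₀ j) := Real.one_le_sqrt.2 (Real.one_le_cosh _)
  nlinarith [abs_nonneg (γ j t)]

end Operators

/-! ### Block operators on H_ρ² -/

section Pairs

variable {ρ : ℝ}

/-- The operator matrix `[[T₁₁, T₁₂], [T₂₁, T₂₂]]` on `H_ρ²`. -/
def blockOp (T₁₁ T₁₂ T₂₁ T₂₂ : Hsp ρ →L[ℂ] Hsp ρ) : Hsp2 ρ →L[ℂ] Hsp2 ρ :=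
  (WithLp.prodContinuousLinearEquiv 2 ℂ (Hsp ρ) (Hsp ρ)).symm.toContinuousLinearMap ∘L
    ((T₁₁.coprod T₁₂).prod (T₂₁.coprod T₂₂)) ∘L
      (WithLp.prodContinuousLinearEquiv 2 ℂ (Hsp ρ) (Hsp ρ)).toContinuousLinearMap

@[simp] lemma blockOp_fst (T₁₁ T₁₂ T₂₁ T₂₂ : Hsp ρ →L[ℂ] Hsp ρ) (u : Hsp2 ρ) :
    (blockOp T₁₁ T₁₂ T₂₁ T₂₂ u).fst = T₁₁ u.fst + T₁₂ u.snd := rfl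

@[simp] lemma blockOp_snd (T₁₁ T₁₂ T₂₁ T₂₂ : Hsp ρ →L[ℂ] Hsp ρ) (u : Hsp2 ρ) :
    (blockOp T₁₁ T₁₂ T₂₁ T₂₂ u).snd = T₂₁ u.fst + T₂₂ u.snd := rfl

lemma Hsp2.ext {u v : Hsp2 ρ} (h1 : u.fst = v.fst) (h2 : u.snd = v.snd) : u = v :=
  WithLp.ofLp_injective 2 (Prod.ext h1 h2)

/-- The Hilbert sum norm loses no constant here. This matters: the bound e^ρ for the shifts on pairs
fixes the width of the strip. -/
lemma norm_blockOp_diag_le (T : Hsp ρ →L[ℂ] Hsp ρ) {C : ℝ} (hT : ‖T‖ ≤ C) :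
    ‖blockOp T 0 0 T‖ ≤ C := by
  have hC : 0 ≤ C := (norm_nonneg _).trans hT
  refine ContinuousLinearMap.opNorm_le_bound _ hC fun u => ?_
  refine le_of_sq_le_sq ?_ (mul_nonneg hC (norm_nonneg _))
  rw [mul_pow, WithLp.prod_norm_sq_eq_of_L2, WithLp.prod_norm_sq_eq_of_L2, mul_add]
  have h : ∀ v, ‖T v‖ ^ 2 ≤ C ^ 2 * ‖v‖ ^ 2 := fun v => by
    rw [← mul_pow]
    exact pow_le_pow_left₀ (norm_nonneg _) (T.le_of_opNorm_le hT v) 2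
  refine add_le_add ?_ ?_
  · simpa using h u.fst
  · simpa using h u.snd

/-- The lower left corner `T ↦ [[0, 0], [T, 0]]`. -/
def cornerOp (ρ : ℝ) : (Hsp ρ →L[ℂ] Hsp ρ) →L[ℂ] (Hsp2 ρ →L[ℂ] Hsp2 ρ) :=
  (ContinuousLinearMap.compL ℂ (Hsp2 ρ) (Hsp ρ) (Hsp2 ρ)
    ((WithLp.prodContinuousLinearEquiv 2 ℂ (Hsp ρ) (Hsp ρ)).symm.toContinuousLinearMap ∘L
      ContinuousLinearMap.inr ℂ (Hsp ρ) (Hsp ρ))) ∘L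
  ((ContinuousLinearMap.compL ℂ (Hsp2 ρ) (Hsp ρ) (Hsp ρ)).flip
    (ContinuousLinearMap.fst ℂ (Hsp ρ) (Hsp ρ) ∘L
      (WithLp.prodContinuousLinearEquiv 2 ℂ (Hsp ρ) (Hsp ρ)).toContinuousLinearMap))

@[simp] lemma cornerOp_fst (T : Hsp ρ →L[ℂ] Hsp ρ) (u : Hsp2 ρ) : (cornerOp ρ T u).fst = 0 := rfl

@[simp] lemma cornerOp_snd (T : Hsp ρ →L[ℂ] Hsp ρ) (u : Hsp2 ρ) :
    (cornerOp ρ T u).snd = T u.fst := rfl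

lemma cornerOp_mem_approxOps {T : Hsp ρ →L[ℂ] Hsp ρ} (hT : T ∈ approxOps (Hsp ρ)) :
    cornerOp ρ T ∈ approxOps (Hsp2 ρ) := by
  refine map_mem_closure (cornerOp ρ).continuous hT fun S hS => ?_
  exact finiteRank_comp _ (comp_finiteRank hS _)

end Pairs

/-! ### The free generator and the spectrum of its exponential -/

section Generator

/-- `H₀` as a bounded operator on `H_ρ`. -/
def freeOp (ρ a b : ℝ) : Hsp ρ →L[ℂ] Hsp ρ :=
  (a : ℂ) • ((2 : ℂ) • 1 - shift ρ (-1) - shift ρ 1) + (b : ℂ) • 1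

lemma freeOp_apply (ρ a b : ℝ) (v : Hsp ρ) (j : ℤ) : freeOp ρ a b v j = opH0 a b v j := by
  have h : freeOp ρ a b v j = a * (2 * v j - v (j + -1) - v (j + 1)) + b * v j := rfl
  rw [h, opH0, gradAdj, grad, grad, add_sub_cancel_right, ← sub_eq_add_neg]
  ring

/-- The generator of the unperturbed equation. -/
def freeGen (ρ a b : ℝ) : Hsp2 ρ →L[ℂ] Hsp2 ρ := blockOp 0 1 (-freeOp ρ a b) 0

/-- The diagonal action of the shift on pairs. -/
def shift2 (ρ : ℝ) (k : ℤ) : Hsp2 ρ →L[ℂ] Hsp2 ρ := blockOp (shift ρ k) 0 0 (shift ρ k)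

lemma shift_mul_shift {ρ : ℝ} {k l : ℤ} (h : k + l = 0) : shift ρ k * shift ρ l = 1 := by
  ext v j
  change v (j + k + l) = v j
  rw [add_assoc, h, add_zero]

lemma shift2_mul_shift2 {ρ : ℝ} {k l : ℤ} (h : k + l = 0) : shift2 ρ k * shift2 ρ l = 1 := by
  ext1 u
  refine Hsp2.ext ?_ ?_
  · have := congrArg (fun T : Hsp ρ →L[ℂ] Hsp ρ => T u.fst) (shift_mul_shift (ρ := ρ) h)
    simpa [shift2] using this
  · have := congrArg (fun T : Hsp ρ →L[ℂ] Hsp ρ => T u.snd) (shift_mul_shift (ρ := ρ) h)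
    simpa [shift2] using this

lemma shift_comm_freeOp (ρ a b : ℝ) (k : ℤ) (v : Hsp ρ) :
    shift ρ k (freeOp ρ a b v) = freeOp ρ a b (shift ρ k v) := by
  ext j
  rw [shift_apply, freeOp_apply, freeOp_apply]
  simp only [opH0, gradAdj, grad, shift_apply]
  ring_nf

lemma shift2_comm_freeGen (ρ a b : ℝ) (k : ℤ) :
    shift2 ρ k * freeGen ρ a b = freeGen ρ a b * shift2 ρ k := by
  ext1 u
  refine Hsp2.ext ?_ ?_ <;> simp [shift2, freeGen, shift_comm_freeOp]

/-- The square is -H₀ on the diagonal, a polynomial in the shifts, so a character's values on the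
shifts determine its value on the generator up to sign. -/
lemma freeGen_mul_self (ρ a b : ℝ) : freeGen ρ a b * freeGen ρ a b =
    -((a : ℂ) • ((2 : ℂ) • 1 - shift2 ρ (-1) - shift2 ρ 1) + (b : ℂ) • 1) := by
  ext1 u
  refine Hsp2.ext ?_ ?_ <;> simp [shift2, freeGen, freeOp]

lemma norm_shift2_le {ρ : ℝ} (hρ : 0 ≤ ρ) {k : ℤ} (hk : |k| = 1) :
    ‖shift2 ρ k‖ ≤ Real.exp ρ := by
  refine norm_blockOp_diag_le _ ((norm_shift_le k).trans ?_)
  have h : |(k : ℝ)| = 1 := by exact_mod_cast congrArg (Int.cast : ℤ → ℝ) hk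
  rw [abs_mul, h, one_mul, abs_of_nonneg hρ]

lemma smul_mul_self_of_eq_neg {R : Type*} [Ring R] [Algebra ℂ R] {c : ℂ} {g y : R}
    (h : g * g = -y) : (c • g) * (c • g) = (-(c ^ 2)) • y := by
  rw [smul_mul_smul_comm, h, smul_neg, neg_smul, sq]

lemma algHom_mul_self {R : Type*} [Ring R] [Algebra ℂ R] (B : Subalgebra ℂ R) (f : B →ₐ[ℂ] ℂ)
    {x σ τ : B} {p a b : ℂ}
    (h : (x : R) * x = p • (a • ((2 : ℂ) • (1 : R) - τ - σ) + b • (1 : R))) :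
    f x * f x = p * (a * (2 - f τ - f σ) + b) := by
  have h' : x * x = p • (a • ((2 : ℂ) • (1 : B) - τ - σ) + b • (1 : B)) := Subtype.ext h
  rw [← map_mul, h']
  simp only [map_smul, map_add, map_sub, map_one, smul_eq_mul, mul_one]

lemma spectrum_exp_freeGen_subset {ρ : ℝ} (hρ : 0 ≤ ρ) (a b : ℝ) :
    spectrum ℂ (NormedSpace.exp (((2 * Real.pi : ℝ) : ℂ) • freeGen ρ a b)) ⊆ SigmaE a b ρ := by
  intro z hz
  set A := ((2 * Real.pi : ℝ) : ℂ) • freeGen ρ a b with hA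
  have hc : ∀ k, shift2 ρ k * A = A * shift2 ρ k := fun k => by
    rw [hA, mul_smul_comm, shift2_comm_freeGen, smul_mul_assoc]
  have hS : shift2 ρ 1 * shift2 ρ (-1) = shift2 ρ (-1) * shift2 ρ 1 := by
    rw [shift2_mul_shift2 (by norm_num), shift2_mul_shift2 (by norm_num)]
  -- With both shifts present, a character takes mutually inverse values of modulus at most e^ρ on
  -- them, so the modulus is bounded from both sides.
  let s : Set (Hsp2 ρ →L[ℂ] Hsp2 ρ) := {A, shift2 ρ 1, shift2 ρ (-1)}
  let B := Subalgebra.centralizer ℂ (Set.centralizer s)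
  obtain ⟨f, hf, hfn⟩ : ∃ f : B →ₐ[ℂ] ℂ,
      Complex.exp (f ⟨A, Set.subset_centralizer_centralizer (by simp [s])⟩) = z ∧
      ∀ y, ‖f y‖ ≤ ‖(y : Hsp2 ρ →L[ℂ] Hsp2 ρ)‖ * ‖(1 : Hsp2 ρ →L[ℂ] Hsp2 ρ)‖ :=
    exists_character_exp (s := s) (by
      rintro x (rfl | rfl | rfl) y (rfl | rfl | rfl) <;> first | rfl | simp only [hc, hS])
      (Set.mem_insert _ _) hz
  let α : B := ⟨A, Set.subset_centralizer_centralizer (by simp [s])⟩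
  let σ : B := ⟨shift2 ρ 1, Set.subset_centralizer_centralizer (by simp [s])⟩
  let τ : B := ⟨shift2 ρ (-1), Set.subset_centralizer_centralizer (by simp [s])⟩
  have hone : ‖(1 : Hsp2 ρ →L[ℂ] Hsp2 ρ)‖ ≤ 1 := ContinuousLinearMap.norm_id_le
  have hbd : ∀ y : B, ‖(y : Hsp2 ρ →L[ℂ] Hsp2 ρ)‖ ≤ Real.exp ρ → ‖f y‖ ≤ Real.exp ρ :=
    fun y hy => (hfn y).trans ((mul_le_of_le_one_right (norm_nonneg _) hone).trans hy)
  have hσ : ‖f σ‖ ≤ Real.exp ρ := hbd σ (norm_shift2_le hρ (by simp))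
  have hτ : ‖f τ‖ ≤ Real.exp ρ := hbd τ (norm_shift2_le hρ (by simp))
  have hστ : f σ * f τ = 1 := by
    rw [← map_mul, ← map_one f]
    exact congrArg f (Subtype.ext (shift2_mul_shift2 (by norm_num)))
  have hsq : f α * f α =
      -((2 * Real.pi) ^ 2 * (a * (2 - f τ - f σ) + b) : ℂ) := by
    have h : A * A = (-((2 * Real.pi) ^ 2 : ℂ)) •
        ((a : ℂ) • ((2 : ℂ) • 1 - shift2 ρ (-1) - shift2 ρ 1) + (b : ℂ) • 1) := by
      rw [hA, smul_mul_self_of_eq_neg (freeGen_mul_self ρ a b)]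
      push_cast
      rfl
    rw [algHom_mul_self B f (x := α) (σ := σ) (τ := τ) h]
    ring
  have hpi : (2 * Real.pi : ℂ) ≠ 0 := by
    exact_mod_cast (by positivity : (2 * Real.pi : ℝ) ≠ 0)
  have hσ0 : f σ ≠ 0 := left_ne_zero_of_mul_eq_one hστ
  have hτσ : f τ = (f σ)⁻¹ := (inv_eq_of_mul_eq_one_right hστ).symm
  -- Here `α` carries the factor 2π. The choice φ = -i log f(σ) gives e^{iφ} = f(σ), hence 2 cos φ =
  -- f(σ) + f(τ) and Im φ = -log ‖f(σ)‖.
  refine ⟨f α / (2 * Real.pi), ⟨-Complex.I * Complex.log (f σ), ?_, ?_⟩, ?_⟩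
  · have him : (-Complex.I * Complex.log (f σ)).im = -Real.log ‖f σ‖ := by
      simp [Complex.log_re]
    change |(-Complex.I * Complex.log (f σ)).im| ≤ ρ
    have hpos : 0 < ‖f σ‖ := norm_pos_iff.2 hσ0
    rw [him, abs_neg, abs_le]
    constructor
    · rw [hτσ, norm_inv] at hτ
      have := Real.log_le_log (inv_pos.2 hpos) hτ
      rw [Real.log_inv, Real.log_exp] at this
      linarith
    · have := Real.log_le_log hpos hσ
      rwa [Real.log_exp] at this
  · have hI : -Complex.I * Complex.log (f σ) * Complex.I = Complex.log (f σ) := by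
      linear_combination (-Complex.log (f σ)) * Complex.I_sq
    have hcos : Complex.cos (-Complex.I * Complex.log (f σ)) = (f σ + f τ) / 2 := by
      rw [Complex.cos, hI, neg_mul, hI, Complex.exp_neg, Complex.exp_log hσ0, hτσ]
    rw [h0, hcos, div_pow, sq (f α), hsq]
    field_simp
    ring
  · change Complex.exp (2 * Real.pi * (f α / (2 * Real.pi))) = z
    rw [mul_div_cancel₀ _ hpi]
    exact hf

end Generator

/-! ### Compactness of the exceptional set -/

section Sigma

/-- By 2π-periodicity of cos, the strip may be cut down to a compact rectangle. -/
lemma rangeR_eq (a b ρ : ℝ) : rangeR a b ρ =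
    h0 a b '' (Set.Icc 0 (2 * Real.pi) ×ℂ Set.Icc (-ρ) ρ) := by
  refine Set.Subset.antisymm ?_ (Set.image_mono fun φ hφ => abs_le.2 hφ.2)
  rintro _ ⟨φ, hφ, rfl⟩
  obtain ⟨y, hy, n, hn⟩ : ∃ y ∈ Set.Ico (0 : ℝ) (0 + 2 * Real.pi), ∃ n : ℤ,
      y = φ.re - n • (2 * Real.pi) :=
    ⟨_, toIcoMod_mem_Ico Real.two_pi_pos 0 φ.re, toIcoDiv Real.two_pi_pos 0 φ.re, rfl⟩
  refine ⟨φ - n * (2 * Real.pi), ⟨?_, ?_⟩, ?_⟩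
  · have : (φ - n * (2 * Real.pi) : ℂ).re = y := by simp [hn]
    rw [Set.mem_preimage, this]
    exact ⟨hy.1, by linarith [hy.2]⟩
  · have : (φ - n * (2 * Real.pi) : ℂ).im = φ.im := by simp
    rw [Set.mem_preimage, this]
    exact abs_le.1 hφ
  · rw [h0, h0, Complex.cos_sub_int_mul_two_pi]

lemma isCompact_rangeR (a b ρ : ℝ) : IsCompact (rangeR a b ρ) := by
  rw [rangeR_eq]
  refine (isCompact_Icc.reProdIm isCompact_Icc).image ?_
  unfold h0
  fun_prop

lemma isCompact_iSqrtR (a b ρ : ℝ) : IsCompact (iSqrtR a b ρ) := by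
  have hcl : IsClosed (iSqrtR a b ρ) :=
    (isCompact_rangeR a b ρ).isClosed.preimage (f := fun z : ℂ => -z ^ 2) (by fun_prop)
  obtain ⟨C, hC⟩ := (isCompact_rangeR a b ρ).isBounded.exists_norm_le
  refine Metric.isCompact_of_isClosed_isBounded hcl
    -- From ‖z‖² ≤ C follows ‖z‖ ≤ C + 1.
    ((Metric.isBounded_closedBall (x := (0 : ℂ)) (r := C + 1)).subset fun z hz => ?_)
  have h := hC _ hz
  rw [norm_neg, norm_pow] at h
  rw [mem_closedBall_zero_iff]
  nlinarith [norm_nonneg z]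

lemma isCompact_SigmaE (a b ρ : ℝ) : IsCompact (SigmaE a b ρ) :=
  (isCompact_iSqrtR a b ρ).image (by fun_prop)

end Sigma

/-! ### Existence and uniqueness of the flow -/

section Flow

variable {α β : ℤ → ℝ → ℝ}

/-- The perturbed generator splits off a continuous family of compact operators. -/
lemma exists_perturbation (ρ : ℝ) (hαβ : IsAdmissible α β) :
    ∃ (K : ℝ → Hsp ρ →L[ℂ] Hsp ρ) (C : ℝ), Continuous K ∧ (∀ t, K t ∈ approxOps (Hsp ρ)) ∧
      (∀ t, ‖K t‖ ≤ C) ∧ ∀ t v j, K t v j = opH1 α β t v j := by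
  obtain ⟨ρ₀, hρ₀, C, hC⟩ := hαβ.decay
  have hα := fun t j => (hC t j).1
  have hβ := fun t j => (hC t j).2
  let Mα : ℝ → Hsp ρ →L[ℂ] Hsp ρ := fun t => mult ρ (fun j => α j t) C (norm_le_of_decay hα t)
  let Mβ : ℝ → Hsp ρ →L[ℂ] Hsp ρ := fun t => mult ρ (fun j => β j t) C (norm_le_of_decay hβ t)
  have hαc : Continuous Mα := continuous_mult (m := fun t j => (α j t : ℂ)) (norm_le_of_decay hα)
    (fun j => Complex.continuous_ofReal.comp (hαβ.continuous_left j))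
    fun ε hε => exists_finset_le hρ₀ hα hε
  have hβc : Continuous Mβ := continuous_mult (m := fun t j => (β j t : ℂ)) (norm_le_of_decay hβ)
    (fun j => Complex.continuous_ofReal.comp (hαβ.continuous_right j))
    fun ε hε => exists_finset_le hρ₀ hβ hε
  have hαk : ∀ t, Mα t ∈ approxOps (Hsp ρ) := fun t =>
    mult_mem_approxOps (norm_le_of_decay hα t) fun ε hε =>
      (exists_finset_le hρ₀ hα hε).imp fun s hs j hj => hs j hj t
  have hβk : ∀ t, Mβ t ∈ approxOps (Hsp ρ) := fun t =>
    mult_mem_approxOps (norm_le_of_decay hβ t) fun ε hε =>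
      (exists_finset_le hρ₀ hβ hε).imp fun s hs j hj => hs j hj t
  have hn : ∀ t, ‖Mα t‖ ≤ C ∧ ‖Mβ t‖ ≤ C := fun t =>
    ⟨norm_ofBound_le _ _ _ _ _, norm_ofBound_le _ _ _ _ _⟩
  -- As operators, ∇₀ = 1 - S₋₁ and ∇₀* = 1 - S₁, so compactness and continuity pass from the
  -- multiplications to H₁(t).
  refine ⟨fun t => (1 - shift ρ 1) * (Mα t * (1 - shift ρ (-1))) + Mβ t,
    ‖1 - shift ρ 1‖ * (C * ‖1 - shift ρ (-1)‖) + C, by fun_prop, fun t => ?_, fun t => ?_,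
    fun t v j => ?_⟩
  · exact add_mem (mul_mem_approxOps_left _ (mul_mem_approxOps_right _ (hαk t))) (hβk t)
  · refine (norm_add_le _ _).trans (add_le_add ((norm_mul_le _ _).trans ?_) (hn t).2)
    refine mul_le_mul_of_nonneg_left ((norm_mul_le _ _).trans ?_) (norm_nonneg _)
    exact mul_le_mul_of_nonneg_right (hn t).1 (norm_nonneg _)
  · change α j t * (v j - v (j + -1)) - α (j + 1) t * (v (j + 1) - v (j + 1 + -1)) + β j t * v j
      = _
    simp only [opH1, gradAdj, grad, ← sub_eq_add_neg]
    ring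

/-- The equation as an ordinary differential equation with a bounded generator. -/
lemma exists_generator (ρ a b : ℝ) (hαβ : IsAdmissible α β) :
    ∃ (K : ℝ → Hsp2 ρ →L[ℂ] Hsp2 ρ) (C : ℝ), Continuous K ∧ (∀ t, K t ∈ approxOps (Hsp2 ρ)) ∧
      (∀ t, ‖freeGen ρ a b + K t‖ ≤ C) ∧ ∀ u : ℝ → Hsp2 ρ,
        IsSolution ρ a b α β u ↔ ∀ t, HasDerivAt u ((freeGen ρ a b + K t) (u t)) t := by
  obtain ⟨K, C, hKc, hKa, hKn, hK⟩ := exists_perturbation ρ hαβ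
  refine ⟨fun t => cornerOp ρ (-K t), ‖freeGen ρ a b‖ + ‖cornerOp ρ‖ * C,
    (cornerOp ρ).continuous.comp hKc.neg, fun t => cornerOp_mem_approxOps (neg_mem (hKa t)),
    fun t => ?_, fun u => forall_congr' fun t => ?_⟩
  · refine (norm_add_le _ _).trans (add_le_add le_rfl (((cornerOp ρ).le_opNorm _).trans ?_))
    rw [norm_neg]
    exact mul_le_mul_of_nonneg_left (hKn t) (norm_nonneg _)
  · have h1 : ((freeGen ρ a b + cornerOp ρ (-K t)) (u t)).fst = (u t).snd := by
      simp [freeGen]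
    have h2 : ∀ j, ((freeGen ρ a b + cornerOp ρ (-K t)) (u t)).snd j =
        -(opH0 a b (u t).fst j + opH1 α β t (u t).fst j) := fun j => by
      rw [← hK, ← freeOp_apply ρ a b]
      simp [freeGen]
      ring
    constructor
    · rintro ⟨w, hw, hw1, hw2⟩
      rwa [Hsp2.ext (hw1.trans h1.symm) (Hsp.ext fun j => (hw2 j).trans (h2 j).symm)] at hw
    · exact fun hw => ⟨_, hw, h1, h2⟩

lemma flow_unique {ρ a b : ℝ} (hαβ : IsAdmissible α β) {Φ Ψ : ℝ → Hsp2 ρ →L[ℂ] Hsp2 ρ}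
    (hΦ : IsFlow ρ a b α β Φ) (hΨ : IsFlow ρ a b α β Ψ) : Ψ = Φ := by
  obtain ⟨K, C, -, -, hC, hsol⟩ := exists_generator ρ a b hαβ
  funext t
  ext1 u₀
  have h := ODE_solution_unique_univ (v := fun t u => (freeGen ρ a b + K t) u)
    (s := fun _ => Set.univ) (K := C.toNNReal) (t₀ := 0)
    (fun t => (((freeGen ρ a b + K t).lipschitz).weaken
      (by rw [← norm_toNNReal]; exact Real.toNNReal_le_toNNReal (hC t))).lipschitzOnWith)
    (fun t => ⟨(hsol _).1 (hΨ u₀).2 t, trivial⟩) (fun t => ⟨(hsol _).1 (hΦ u₀).2 t, trivial⟩)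
    ((hΨ u₀).1.trans (hΦ u₀).1.symm)
  exact congrFun h t

lemma exists_flow (ρ a b : ℝ) (hαβ : IsAdmissible α β) :
    ∃ Φ : ℝ → Hsp2 ρ →L[ℂ] Hsp2 ρ, IsFlow ρ a b α β Φ ∧
      ∀ t : ℝ, Φ t - NormedSpace.exp ((t : ℂ) • freeGen ρ a b) ∈ approxOps (Hsp2 ρ) := by
  obtain ⟨K, C, hKc, hKa, hC, hsol⟩ := exists_generator ρ a b hαβ
  obtain ⟨Φ, hΦ0, hΦ, hΦc⟩ := exists_solutionOp (freeGen ρ a b) hKc hKa hC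
  exact ⟨Φ, fun u₀ => ⟨hΦ0 u₀, (hsol _).2 (hΦ u₀)⟩, hΦc⟩

end Flow

end Breather

end

theorem theorem2p4 (ρ : ℝ) (hρ : 0 ≤ ρ) (a b : ℝ) (α β : ℤ → ℝ → ℝ)
    (hαβ : Breather.IsAdmissible α β)
    (hconn : IsConnected (Breather.SigmaE a b ρ)ᶜ) :
    ∃ Φ : ℝ → Breather.Hsp2 ρ →L[ℂ] Breather.Hsp2 ρ,
      Breather.IsFlow ρ a b α β Φ ∧
      (∀ Ψ : ℝ → Breather.Hsp2 ρ →L[ℂ] Breather.Hsp2 ρ,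
        Breather.IsFlow ρ a b α β Ψ → Ψ = Φ) ∧
      (∀ μ ∈ spectrum ℂ (Φ (2 * Real.pi)), μ ∉ Breather.SigmaE a b ρ →
        Module.End.HasEigenvalue
          (Φ (2 * Real.pi) : Breather.Hsp2 ρ →ₗ[ℂ] Breather.Hsp2 ρ) μ ∧
        Breather.HasFiniteAlgMultiplicity (Φ (2 * Real.pi)) μ) ∧
      (∀ z : ℂ,
        AccPt z (Filter.principal (spectrum ℂ (Φ (2 * Real.pi)) \ Breather.SigmaE a b ρ)) →
          z ∈ Breather.SigmaE a b ρ) := by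
  obtain ⟨Φ, hΦ, hΦc⟩ := Breather.exists_flow ρ a b hαβ
  -- Σ and the spectrum are both bounded, so they cannot cover the plane; this supplies the regular
  -- point off Σ from which the Fredholm alternative is decided.
  have hne : ((Breather.SigmaE a b ρ)ᶜ \ spectrum ℂ (Φ (2 * Real.pi))).Nonempty := by
    have hb := (Breather.isCompact_SigmaE a b ρ).isBounded.union
      (spectrum.isBounded (𝕜 := ℂ) (Φ (2 * Real.pi)))
    obtain ⟨z, hz⟩ := Set.nonempty_compl.2 fun h =>
      NormedSpace.unbounded_univ ℂ ℂ (h ▸ hb)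
    exact ⟨z, fun h => hz (Or.inl h), fun h => hz (Or.inr h)⟩
  obtain ⟨h1, h2⟩ := Breather.analytic_fredholm _ _ (hΦc (2 * Real.pi)) hconn.isPreconnected
    (fun z hz => by
      by_contra h
      exact hz (Breather.spectrum_exp_freeGen_subset hρ a b h)) hne
  refine ⟨Φ, hΦ, fun Ψ hΨ => Breather.flow_unique hαβ hΦ hΨ, fun μ hμ hμs => h1 μ hμs hμ,
    fun z hz => ?_⟩
  by_contra hzs
  rw [accPt_iff_frequently_nhdsNE] at hz
  exact hz ((h2 z hzs).mono fun w hw hws => hw hws.1)
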